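/- All vector spaces are over $\mathbb{K}=\mathbb{R}$ or $\mathbb{C}$. Let $(X,\|\cdot\|_X)$ be a quasi-Banach space and let $Y\subseteq X$ be a linear subspace with $Y\neq X$ that is itself a quasi-Banach space under a quasi-norm $\|\cdot\|_Y$ and is continuously embedded into $X$, i.e. $\|y\|_X\le M\|y\|_Y$ for all $y\in Y$ and some constant $M$. For $x\in X$ and $t>0$ let $$K(x,t,X,Y)=\inf_{y\in Y}\bigl(\|x-y\|_X+t\|y\|_Y\bigr),$$ and for $0<\theta<1$, $0<q\le\infty$ (with $1/\infty=0$) let $$(X,Y)_{\theta,q}=\Bigl\{x\in X:\ \bigl\|t^{-(\theta+1/q)}K(x,t,X,Y)\bigr\|_{L^q(0,\infty)}<\infty\Bigr\},$$ which is a linear subspace of $X$. Then: (a) If $Y$ is not closed in $X$, then $(X,Y)_{\theta_0,p}\neq (X,Y)_{\theta_1,q}$ for all $\theta_0,\theta_1\in(0,1)$ with $\theta_0\neq\theta_1$ and all $0<p,q\le\infty$. (b) If $0<\theta<1$ and $0<p,q\le\infty$ are such that $(X,Y)_{\theta,p}\neq(X,Y)_{\theta,q}$, then $(X,Y)_{\theta,r_1}\neq(X,Y)_{\theta,r_2}$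 for all $r_1\neq r_2$ in the closed interval with endpoints $p$ and $q$. (c) If $Y$ is not closed in $X$, then for all $0<\theta<1$ and $0<p\le\infty$ the space $(X,Y)_{\theta,p}$ has infinite codimension in $X$, and $Y$ is contained in $(X,Y)_{\theta,p}$ and has infinite codimension in it. -/

import Mathlib

open MeasureTheory Filter Topology
open scoped ENNReal

/-- A quasi-norm on a vector space `E` over `𝕜 = ℝ` or `ℂ`: a norm, except that the triangle
inequality is only required up to a multiplicative constant. -/
structure QuasiNorm (𝕜 : Type*) [RCLike 𝕜] (E : Type*) [AddCommGroup E] [Module 𝕜 E] where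
  /-- The underlying function. -/
  toFun : E → ℝ
  nonneg' : ∀ x, 0 ≤ toFun x
  eq_zero_iff' : ∀ x, toFun x = 0 ↔ x = 0
  smul' : ∀ (c : 𝕜) (x : E), toFun (c • x) = ‖c‖ * toFun x
  exists_add_le' : ∃ C : ℝ, ∀ x y, toFun (x + y) ≤ C * (toFun x + toFun y)

namespace QuasiNorm

variable {𝕜 : Type*} [RCLike 𝕜] {E : Type*} [AddCommGroup E] [Module 𝕜 E]

instance : CoeFun (QuasiNorm 𝕜 E) (fun _ => E → ℝ) := ⟨QuasiNorm.toFun⟩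

/-- `(E, N)` is a quasi-Banach space: every `N`-Cauchy sequence `N`-converges. -/
def IsQuasiBanach (N : QuasiNorm 𝕜 E) : Prop :=
  ∀ u : ℕ → E,
    (∀ ε : ℝ, 0 < ε → ∃ n₀ : ℕ, ∀ m n : ℕ, n₀ ≤ m → n₀ ≤ n → N (u m - u n) < ε) →
    ∃ x : E, Tendsto (fun n => N (u n - x)) atTop (𝓝 0)

/-- The set `S` is closed in `(E, N)`: it contains the limits of all its `N`-convergent
sequences. (The topology of a quasi-norm is metrizable, so this is closedness.) -/
def IsClosedSet (N : QuasiNorm 𝕜 E) (S : Set E) : Prop :=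
  ∀ (u : ℕ → E) (x : E), (∀ n, u n ∈ S) → Tendsto (fun n => N (u n - x)) atTop (𝓝 0) → x ∈ S

/-- The inclusion of the quasi-normed space `(Y, NY)`, `Y` a linear subspace of `X`, into
`(X, NX)` is continuous, that is, bounded. -/
def ContinuouslyEmbedded (NX : QuasiNorm 𝕜 E) {Y : Submodule 𝕜 E} (NY : QuasiNorm 𝕜 Y) : Prop :=
  ∃ M : ℝ, ∀ y : Y, NX (y : E) ≤ M * NY y

/-- Peetre's `K`-functional `K(x, t, X, Y) = inf_{y ∈ Y} (‖x - y‖_X + t ‖y‖_Y)`, for `t > 0`. -/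
noncomputable def peetreK (NX : QuasiNorm 𝕜 E) {Y : Submodule 𝕜 E} (NY : QuasiNorm 𝕜 Y)
    (x : E) (t : ℝ) : ℝ :=
  ⨅ y : Y, (NX (x - (y : E)) + t * NY y)

/-- `ρ_{θ,q}(x) = ‖t ^ (-(θ + 1/q)) K(x, t, X, Y)‖_{L^q(0,∞)}`, with values in `[0, ∞]`
(`1/∞ = 0`, and `L^∞` is the essential supremum). -/
noncomputable def interpFunctional (NX : QuasiNorm 𝕜 E) {Y : Submodule 𝕜 E} (NY : QuasiNorm 𝕜 Y)
    (θ : ℝ) (q : ℝ≥0∞) (x : E) : ℝ≥0∞ :=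
  eLpNorm (fun t : ℝ => t ^ (-(θ + (q⁻¹).toReal)) * peetreK NX NY x t) q
    (volume.restrict (Set.Ioi (0 : ℝ)))

theorem peetreK_bdd (NX : QuasiNorm 𝕜 E) {Y : Submodule 𝕜 E} (NY : QuasiNorm 𝕜 Y)
    (x : E) {t : ℝ} (ht : 0 ≤ t) :
    BddBelow (Set.range fun y : Y => NX (x - (y : E)) + t * NY y) :=
  ⟨0, by
    rintro _ ⟨y, rfl⟩
    exact add_nonneg (NX.nonneg' _) (mul_nonneg ht (NY.nonneg' _))⟩

theorem peetreK_nonneg (NX : QuasiNorm 𝕜 E) {Y : Submodule 𝕜 E} (NY : QuasiNorm 𝕜 Y)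
    (x : E) {t : ℝ} (ht : 0 ≤ t) : 0 ≤ peetreK NX NY x t :=
  le_ciInf fun _ => add_nonneg (NX.nonneg' _) (mul_nonneg ht (NY.nonneg' _))

theorem peetreK_zero (NX : QuasiNorm 𝕜 E) {Y : Submodule 𝕜 E} (NY : QuasiNorm 𝕜 Y)
    {t : ℝ} (ht : 0 ≤ t) : peetreK NX NY 0 t = 0 := by
  refine le_antisymm ?_ (peetreK_nonneg NX NY 0 ht)
  refine (ciInf_le (peetreK_bdd NX NY 0 ht) 0).trans ?_
  have h1 : NX.toFun 0 = 0 := (NX.eq_zero_iff' 0).2 rfl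
  have h2 : NY.toFun 0 = 0 := (NY.eq_zero_iff' 0).2 rfl
  simp [h1, h2]

theorem peetreK_smul_le (NX : QuasiNorm 𝕜 E) {Y : Submodule 𝕜 E} (NY : QuasiNorm 𝕜 Y)
    (c : 𝕜) (x : E) {t : ℝ} (ht : 0 ≤ t) :
    peetreK NX NY (c • x) t ≤ ‖c‖ * peetreK NX NY x t := by
  unfold peetreK
  rw [Real.mul_iInf_of_nonneg (norm_nonneg c)]
  refine le_ciInf fun y => (ciInf_le (peetreK_bdd NX NY (c • x) ht) (c • y)).trans_eq ?_
  rw [Submodule.coe_smul, ← smul_sub, NX.smul', NY.smul']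
  ring

theorem exists_peetreK_add_le (NX : QuasiNorm 𝕜 E) {Y : Submodule 𝕜 E} (NY : QuasiNorm 𝕜 Y) :
    ∃ C : ℝ, 0 < C ∧ ∀ (x x' : E) (t : ℝ), 0 ≤ t →
      peetreK NX NY (x + x') t ≤ C * (peetreK NX NY x t + peetreK NX NY x' t) := by
  obtain ⟨A, hA⟩ := NX.exists_add_le'
  obtain ⟨B, hB⟩ := NY.exists_add_le'
  have hC : 0 < max 1 (max A B) := lt_max_of_lt_left one_pos
  refine ⟨max 1 (max A B), hC, fun x x' t ht => ?_⟩
  set C := max 1 (max A B)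
  have hAC : A ≤ C := (le_max_left _ _).trans (le_max_right _ _)
  have hBC : B ≤ C := (le_max_right _ _).trans (le_max_right _ _)
  rw [← div_le_iff₀' hC]
  unfold peetreK
  refine le_ciInf_add_ciInf fun y y' => ?_
  rw [div_le_iff₀' hC]
  refine (ciInf_le (peetreK_bdd NX NY (x + x') ht) (y + y')).trans ?_
  have e : x + x' - ((y + y' : Y) : E) = (x - y) + (x' - y') := by
    rw [Submodule.coe_add]; abel
  rw [e]
  have h1 := (hA (x - y) (x' - y')).trans
    (mul_le_mul_of_nonneg_right hAC (add_nonneg (NX.nonneg' _) (NX.nonneg' _)))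
  have h2 := mul_le_mul_of_nonneg_left ((hB y y').trans
    (mul_le_mul_of_nonneg_right hBC (add_nonneg (NY.nonneg' _) (NY.nonneg' _)))) ht
  linarith

theorem peetreK_aestronglyMeasurable (NX : QuasiNorm 𝕜 E) {Y : Submodule 𝕜 E}
    (NY : QuasiNorm 𝕜 Y) (s : ℝ) (x : E) :
    AEStronglyMeasurable (fun t : ℝ => t ^ s * peetreK NX NY x t)
      (volume.restrict (Set.Ioi (0 : ℝ))) := by
  have hK : AEMeasurable (peetreK NX NY x) (volume.restrict (Set.Ioi (0 : ℝ))) := by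
    refine aemeasurable_restrict_of_monotoneOn measurableSet_Ioi fun t ht t' _ htt => ?_
    exact ciInf_mono (peetreK_bdd NX NY x (le_of_lt ht)) fun y =>
      add_le_add_right (mul_le_mul_of_nonneg_right htt (NY.nonneg' y)) _
  exact ((measurable_id.pow_const s).aemeasurable.mul hK).aestronglyMeasurable

/-- The real interpolation space `(X, Y)_{θ,q} = {x ∈ X : ρ_{θ,q}(x) < ∞}`, as a linear subspace
of `X`. -/
noncomputable def interp (NX : QuasiNorm 𝕜 E) {Y : Submodule 𝕜 E} (NY : QuasiNorm 𝕜 Y)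
    (θ : ℝ) (q : ℝ≥0∞) : Submodule 𝕜 E where
  carrier := {x | interpFunctional NX NY θ q x < ∞}
  zero_mem' := by
    have h : (fun t : ℝ => t ^ (-(θ + (q⁻¹).toReal)) * peetreK NX NY 0 t)
        =ᵐ[volume.restrict (Set.Ioi (0 : ℝ))] 0 := by
      filter_upwards [ae_restrict_mem measurableSet_Ioi] with t ht
      simp [peetreK_zero NX NY (le_of_lt ht)]
    change eLpNorm _ q _ < ∞
    rw [eLpNorm_congr_ae h, eLpNorm_zero]
    exact ENNReal.zero_lt_top
  add_mem' := by
    intro x x' hx hx'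
    obtain ⟨C, hC, h⟩ := exists_peetreK_add_le NX NY
    have hm : MemLp _ q (volume.restrict (Set.Ioi (0 : ℝ))) :=
      ⟨peetreK_aestronglyMeasurable NX NY (-(θ + (q⁻¹).toReal)) x, hx⟩
    have hm' : MemLp _ q (volume.restrict (Set.Ioi (0 : ℝ))) :=
      ⟨peetreK_aestronglyMeasurable NX NY (-(θ + (q⁻¹).toReal)) x', hx'⟩
    refine (eLpNorm_mono_ae ?_).trans_lt ((hm.add hm').const_mul C).2
    filter_upwards [ae_restrict_mem measurableSet_Ioi] with t ht
    have ht0 : (0 : ℝ) ≤ t := le_of_lt ht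
    have hp := Real.rpow_nonneg ht0 (-(θ + (q⁻¹).toReal))
    rw [Real.norm_of_nonneg (mul_nonneg hp (peetreK_nonneg NX NY _ ht0))]
    refine le_trans ?_ (le_abs_self _)
    refine (mul_le_mul_of_nonneg_left (h x x' t ht0) hp).trans_eq ?_
    simp only [Pi.add_apply]
    ring
  smul_mem' := by
    intro c x hx
    have hm : MemLp _ q (volume.restrict (Set.Ioi (0 : ℝ))) :=
      ⟨peetreK_aestronglyMeasurable NX NY (-(θ + (q⁻¹).toReal)) x, hx⟩
    refine (eLpNorm_mono_ae ?_).trans_lt (hm.const_mul ‖c‖).2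
    filter_upwards [ae_restrict_mem measurableSet_Ioi] with t ht
    have ht0 : (0 : ℝ) ≤ t := le_of_lt ht
    have hp := Real.rpow_nonneg ht0 (-(θ + (q⁻¹).toReal))
    rw [Real.norm_of_nonneg (mul_nonneg hp (peetreK_nonneg NX NY _ ht0))]
    refine le_trans ?_ (le_abs_self _)
    refine (mul_le_mul_of_nonneg_left (peetreK_smul_le NX NY c x ht0) hp).trans_eq ?_
    ring

end QuasiNorm

/-- The linear subspace `A` has infinite codimension in the linear subspace `B` of `E`:
`A ⊆ B` and the quotient `B / A` is infinite-dimensional. -/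
def HasInfiniteCodimIn {𝕜 E : Type*} [Field 𝕜] [AddCommGroup E] [Module 𝕜 E]
    (A B : Submodule 𝕜 E) : Prop :=
  A ≤ B ∧ ¬ FiniteDimensional 𝕜 (B ⧸ A.submoduleOf B)

/-!
Write `K` and `J` for Peetre's functionals, and suppose first that `Y` is not closed. Then there is
`c > 0` such that at arbitrarily small scales `t` some `u ∈ Y` has `J(u, t) ≤ 1` and `c ≤ K(u, t)`.
Otherwise `K(u, t)` would be a small multiple of `J(u, t)` on `Y` at every small scale; iterating
the splittings `u = (u - y) + y` would then yield a fixed scale at which every `u ∈ Y` is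
approximated in `X`, up to a small multiple of `‖u‖_X`, by some `w ∈ Y` with `‖w‖_Y = O(‖u‖_X)`.
Summing up the approximants in the complete space `Y` would make the two quasi-norms equivalent on
`Y`, and `Y` would be closed.

Such vectors `u_n` at rapidly decreasing scales `t_n` do not interfere: for a slowly varying bounded
sequence `a`, the sum `x` of the vectors `a_n t_n ^ θ u_n` has `K(x, t_n)` comparable with
`a_n t_n ^ θ`, with geometric decay of `s ^ (-θ) K(x, s)` between the scales. Hence
`x ∈ (X, Y)_{θ, q}` if and only if `a ∈ ℓ^q`, and `a_n = (n + 1) ^ (-1 / p)` separates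
`(X, Y)_{θ, p}` from all `(X, Y)_{θ, q}` with `p < q`. Since the spaces decrease in `θ` whatever the
second exponents are, two of them with different `θ` enclose a strict inclusion, and letting `θ`
vary along a sequence produces infinite strict chains and hence infinite codimension.

If `Y` is closed, all the interpolation spaces are equal to `Y`.
-/

section Rpow

theorem rpow_le_rpow_mul_rpow_of_le_mul {δ l η s t : ℝ} (hδ0 : 0 < δ) (hδ1 : δ ≤ 1) (hs : 0 ≤ s)
    (ht : 0 ≤ t) (hst : s ≤ δ * t) (hη : 0 ≤ η) (hl : l ≤ η) : s ^ η ≤ δ ^ l * t ^ η :=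
  calc s ^ η ≤ (δ * t) ^ η := Real.rpow_le_rpow hs hst hη
    _ = δ ^ η * t ^ η := Real.mul_rpow hδ0.le ht
    _ ≤ δ ^ l * t ^ η := by
        gcongr ?_ * _
        exact Real.rpow_le_rpow_of_exponent_ge hδ0 hδ1 hl

theorem rpow_mul_min_one_div_le {s t : ℝ} (hs : 0 < s) (ht : 0 < t) (θ : ℝ) :
    t ^ θ * min 1 (s / t) ≤ s ^ θ * min (t / s) (s / t) ^ min θ (1 - θ) := by
  rcases le_total t s with h | h
  · have h1 : t / s ≤ 1 := (div_le_one hs).2 h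
    have h2 : 1 ≤ s / t := (one_le_div ht).2 h
    rw [min_eq_left h2, min_eq_left (h1.trans h2), mul_one]
    calc t ^ θ = s ^ θ * (t / s) ^ θ := by
          rw [← Real.mul_rpow hs.le (by positivity), mul_div_cancel₀ _ hs.ne']
      _ ≤ _ := mul_le_mul_of_nonneg_left
          (Real.rpow_le_rpow_of_exponent_ge (by positivity) h1 (min_le_left _ _)) (by positivity)
  · have h1 : s / t ≤ 1 := (div_le_one ht).2 h
    have h2 : 1 ≤ t / s := (one_le_div hs).2 h
    rw [min_eq_right h1, min_eq_right (h1.trans h2)]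
    calc t ^ θ * (s / t) = s ^ θ * (s / t) ^ (1 - θ) := by
          rw [Real.rpow_sub (by positivity), Real.rpow_one, Real.div_rpow hs.le ht.le]
          field_simp
      _ ≤ _ := mul_le_mul_of_nonneg_left
          (Real.rpow_le_rpow_of_exponent_ge (by positivity) h1 (min_le_right _ _)) (by positivity)

theorem lintegral_Ioc_inv_mul_div_rpow {T τ : ℝ} (hT : 0 < T) (hτ : 0 < τ) :
    ∫⁻ s in Set.Ioc 0 T, ENNReal.ofReal (s⁻¹ * (s / T) ^ τ) = ENNReal.ofReal (1 / τ) := by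
  have hrpow : ∀ s ∈ Set.Ioc 0 T, s⁻¹ * (s / T) ^ τ = (T ^ τ)⁻¹ * s ^ (τ - 1) := fun s hs => by
    rw [Real.div_rpow hs.1.le hT.le, Real.rpow_sub_one hs.1.ne']
    field_simp
  have hint : IntegrableOn (fun s : ℝ => (T ^ τ)⁻¹ * s ^ (τ - 1)) (Set.Ioc 0 T) :=
    ((intervalIntegrable_iff_integrableOn_Ioc_of_le hT.le).1
      (intervalIntegral.intervalIntegrable_rpow' (by linarith))).const_mul _
  rw [setLIntegral_congr_fun measurableSet_Ioc fun s hs => by rw [hrpow s hs],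
    ← ofReal_integral_eq_lintegral_ofReal hint, integral_const_mul,
    ← intervalIntegral.integral_of_le hT.le, integral_rpow (Or.inl (by linarith)),
    sub_add_cancel, Real.zero_rpow hτ.ne', sub_zero]
  · congr 1
    field_simp
  · filter_upwards [ae_restrict_mem measurableSet_Ioc] with s hs
    have := hs.1
    positivity

theorem lintegral_Ioi_inv_mul_div_rpow {T τ : ℝ} (hT : 0 < T) (hτ : 0 < τ) :
    ∫⁻ s in Set.Ioi T, ENNReal.ofReal (s⁻¹ * (T / s) ^ τ) = ENNReal.ofReal (1 / τ) := by
  have hrpow : ∀ s ∈ Set.Ioi T, s⁻¹ * (T / s) ^ τ = T ^ τ * s ^ (-τ - 1) := fun s hs => by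
    have hs0 : 0 < s := hT.trans hs
    rw [Real.div_rpow hT.le hs0.le, Real.rpow_sub_one hs0.ne', Real.rpow_neg hs0.le]
    field_simp
  have hint : IntegrableOn (fun s : ℝ => T ^ τ * s ^ (-τ - 1)) (Set.Ioi T) :=
    (integrableOn_Ioi_rpow_of_lt (by linarith) hT).const_mul _
  rw [setLIntegral_congr_fun measurableSet_Ioi fun s hs => by rw [hrpow s hs],
    ← ofReal_integral_eq_lintegral_ofReal hint, integral_const_mul,
    integral_Ioi_rpow_of_lt (by linarith) hT, sub_add_cancel, Real.rpow_neg hT.le]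
  · congr 1
    field_simp
  · filter_upwards [ae_restrict_mem measurableSet_Ioi] with s (hs : T < s)
    have := hT.trans hs
    positivity

theorem lintegral_inv_mul_min_div_rpow_le {T τ : ℝ} (hT : 0 < T) (hτ : 0 < τ) :
    ∫⁻ s in Set.Ioi (0 : ℝ), ENNReal.ofReal (s⁻¹ * min (T / s) (s / T) ^ τ) ≤
      ENNReal.ofReal (1 / τ) + ENNReal.ofReal (1 / τ) := by
  rw [← Set.Ioc_union_Ioi_eq_Ioi hT.le]
  refine (lintegral_union_le _ _ _).trans (add_le_add ?_ ?_)
  · rw [← lintegral_Ioc_inv_mul_div_rpow hT hτ]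
    refine setLIntegral_mono' measurableSet_Ioc fun s hs => ENNReal.ofReal_le_ofReal ?_
    have hs0 : 0 < s := hs.1
    gcongr
    exact min_le_right _ _
  · rw [← lintegral_Ioi_inv_mul_div_rpow hT hτ]
    refine setLIntegral_mono' measurableSet_Ioi fun s (hs : T < s) => ENNReal.ofReal_le_ofReal ?_
    have hs0 : 0 < s := hT.trans hs
    gcongr
    exact min_le_left _ _

theorem min_div_div_le_one {s t : ℝ} (hs : 0 < s) (ht : 0 < t) : min (s / t) (t / s) ≤ 1 := by
  rcases le_total s t with h | h
  · exact (min_le_left _ _).trans ((div_le_one ht).2 h)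
  · exact (min_le_right _ _).trans ((div_le_one hs).2 h)

theorem lintegral_inv_mul_rpow_lt_top {ι : Type*} [Countable ι] {τ r : ℝ} (hτ : 0 < τ)
    (hr : 0 < r) {a t : ι → ℝ} (ha : ∀ m, 0 ≤ a m) (ht : ∀ m, 0 < t m)
    (hsum : Summable fun m => a m ^ r) {F : ℝ → ℝ}
    (hF : ∀ s > 0, 0 ≤ F s ∧ ∃ m, F s ≤ a m * min (t m / s) (s / t m) ^ τ) :
    ∫⁻ s in Set.Ioi (0 : ℝ), ENNReal.ofReal (s⁻¹ * F s ^ r) < ∞ := by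
  have hbound : ∀ s ∈ Set.Ioi (0 : ℝ), ENNReal.ofReal (s⁻¹ * F s ^ r) ≤
      ∑' m, ENNReal.ofReal (a m ^ r) *
        ENNReal.ofReal (s⁻¹ * min (t m / s) (s / t m) ^ (τ * r)) := fun s (hs : 0 < s) => by
    obtain ⟨hF0, m, hm⟩ := hF s hs
    have htm := ht m
    have ham := ha m
    refine le_trans ?_ (ENNReal.le_tsum m)
    rw [← ENNReal.ofReal_mul (by positivity)]
    refine ENNReal.ofReal_le_ofReal ?_
    calc s⁻¹ * F s ^ r ≤ s⁻¹ * (a m * min (t m / s) (s / t m) ^ τ) ^ r := by gcongr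
      _ = a m ^ r * (s⁻¹ * min (t m / s) (s / t m) ^ (τ * r)) := by
          rw [Real.mul_rpow ham (by positivity), ← Real.rpow_mul (by positivity), mul_left_comm]
  calc ∫⁻ s in Set.Ioi (0 : ℝ), ENNReal.ofReal (s⁻¹ * F s ^ r)
      ≤ ∑' m, ENNReal.ofReal (a m ^ r) * ∫⁻ s in Set.Ioi (0 : ℝ),
          ENNReal.ofReal (s⁻¹ * min (t m / s) (s / t m) ^ (τ * r)) := by
        refine (setLIntegral_mono' measurableSet_Ioi hbound).trans_eq ?_
        rw [lintegral_tsum fun m => by fun_prop]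
        exact tsum_congr fun m => lintegral_const_mul _ (by fun_prop)
    _ ≤ ∑' m, ENNReal.ofReal (a m ^ r) *
          (ENNReal.ofReal (1 / (τ * r)) + ENNReal.ofReal (1 / (τ * r))) := by
        gcongr with m
        exact lintegral_inv_mul_min_div_rpow_le (ht m) (mul_pos hτ hr)
    _ < ∞ := by
        rw [ENNReal.tsum_mul_right]
        exact ENNReal.mul_lt_top hsum.tsum_ofReal_lt_top
          (ENNReal.add_lt_top.2 ⟨ENNReal.ofReal_lt_top, ENNReal.ofReal_lt_top⟩)

end Rpow

theorem exists_seq_succ_le_mul {P : ℝ → Prop} (hP : ∀ T > 0, ∃ t, 0 < t ∧ t < T ∧ P t) {δ : ℝ}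
    (hδ : 0 < δ) : ∃ t : ℕ → ℝ, ∀ n, 0 < t n ∧ P (t n) ∧ t (n + 1) ≤ δ * t n := by
  have hnext : ∀ T : Set.Ioi (0 : ℝ), ∃ t : Set.Ioi (0 : ℝ), (t : ℝ) < δ * T ∧ P t := fun T =>
    let ⟨t, ht0, htT, ht⟩ := hP (δ * T) (mul_pos hδ T.2)
    ⟨⟨t, ht0⟩, htT, ht⟩
  choose next hlt hPnext using hnext
  refine ⟨fun n => next (next^[n] ⟨1, Set.mem_Ioi.2 one_pos⟩), fun n => ⟨(next _).2, hPnext _, ?_⟩⟩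
  simp only [Function.iterate_succ_apply']
  exact (hlt _).le

theorem memℓp_add_one_rpow_neg_inv_iff {p q : ℝ≥0∞} (hp0 : p ≠ 0) (hp : p ≠ ∞) (hq : q ≠ 0) :
    Memℓp (fun n : ℕ => ((n : ℝ) + 1) ^ (-p.toReal⁻¹)) q ↔ p < q := by
  have hp' := ENNReal.toReal_pos hp0 hp
  rcases eq_or_ne q ∞ with rfl | hq'
  · refine iff_of_true (memℓp_infty ⟨1, ?_⟩) hp.lt_top
    rintro _ ⟨n, rfl⟩
    exact (Real.norm_of_nonneg (by positivity)).trans_le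
      (Real.rpow_le_one_of_one_le_of_nonpos (by simp) (by simp))
  · have hterm : ∀ n : ℕ, ‖((n : ℝ) + 1) ^ (-p.toReal⁻¹)‖ ^ q.toReal =
        1 / |(n : ℝ) + 1| ^ (q.toReal / p.toReal) := fun n => by
      have hn : 0 < (n : ℝ) + 1 := by positivity
      rw [Real.norm_of_nonneg (by positivity), abs_of_pos hn, ← Real.rpow_mul hn.le, one_div,
        ← Real.rpow_neg hn.le, neg_mul, inv_mul_eq_div]
    simp only [memℓp_gen_iff (ENNReal.toReal_pos hq hq'), hterm]
    rw [Real.summable_one_div_nat_add_rpow, one_lt_div hp', ENNReal.toReal_lt_toReal hp hq']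

theorem tsum_eLpNorm_restrict_rpow_le {α F : Type*} [MeasurableSpace α] {μ : Measure α}
    [NormedAddCommGroup F] (f : α → F) {q : ℝ≥0∞} (hq0 : q ≠ 0) (hq : q ≠ ∞) {s : ℕ → Set α}
    {S : Set α} (hs : ∀ n, MeasurableSet (s n)) (hdisj : Pairwise (Function.onFun Disjoint s))
    (hsS : ∀ n, s n ⊆ S) :
    ∑' n, eLpNorm f q (μ.restrict (s n)) ^ q.toReal ≤ eLpNorm f q (μ.restrict S) ^ q.toReal := by
  have hpow : ∀ A, eLpNorm f q (μ.restrict A) ^ q.toReal = ∫⁻ a in A, ‖f a‖ₑ ^ q.toReal ∂μ :=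
    fun A => by
      rw [eLpNorm_eq_lintegral_rpow_enorm_toReal hq0 hq, one_div,
        ENNReal.rpow_inv_rpow (ENNReal.toReal_pos hq0 hq).ne']
  simp only [hpow]
  rw [← lintegral_iUnion hs hdisj]
  exact lintegral_mono_set (Set.iUnion_subset hsS)

theorem HasInfiniteCodimIn.of_strictAnti {𝕜 E : Type*} [Field 𝕜] [AddCommGroup E] [Module 𝕜 E]
    {A B : Submodule 𝕜 E} {S : ℕ → Submodule 𝕜 E} (hS : StrictAnti S) (hA : ∀ n, A ≤ S n)
    (hB : ∀ n, S n ≤ B) : HasInfiniteCodimIn A B := by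
  refine ⟨(hA 0).trans (hB 0), fun hfin => ?_⟩
  let f : ℕ →o (Submodule 𝕜 (B ⧸ A.submoduleOf B))ᵒᵈ :=
    ⟨fun n => OrderDual.toDual (((S n).submoduleOf B).map (A.submoduleOf B).mkQ),
      fun m n hmn => Submodule.map_mono (Submodule.comap_mono (hS.antitone hmn))⟩
  obtain ⟨n, hn⟩ := IsArtinian.monotone_stabilizes f
  have hquot : ((S n).submoduleOf B).map (A.submoduleOf B).mkQ
      = ((S (n + 1)).submoduleOf B).map (A.submoduleOf B).mkQ := hn (n + 1) n.le_succ
  have hsub := congrArg (Submodule.comap (A.submoduleOf B).mkQ) hquot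
  rw [Submodule.comap_map_mkQ, Submodule.comap_map_mkQ,
    sup_eq_right.2 (Submodule.comap_mono (hA n)),
    sup_eq_right.2 (Submodule.comap_mono (hA (n + 1)))] at hsub
  refine (hS n.lt_succ_self).not_ge fun x hx => ?_
  have hmem : (⟨x, hB n hx⟩ : B) ∈ (S (n + 1)).submoduleOf B := hsub ▸ hx
  exact hmem

/-- Quasi-subadditivity: the triangle inequality up to the factor `C`. It is shared by the two
quasi-norms and by the `K`-functionals, which need not be quasi-norms. -/
def IsQuasiSubadditive {E : Type*} [Add E] (C : ℝ) (f : E → ℝ) : Prop :=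
  ∀ x y, f (x + y) ≤ C * (f x + f y)

namespace IsQuasiSubadditive

theorem mono {E : Type*} [Add E] {C C' : ℝ} {f : E → ℝ} (hf : IsQuasiSubadditive C f)
    (hC : C ≤ C') (hf0 : ∀ x, 0 ≤ f x) : IsQuasiSubadditive C' f := fun x y =>
  (hf x y).trans (mul_le_mul_of_nonneg_right hC (add_nonneg (hf0 x) (hf0 y)))

variable {E : Type*} [AddCommMonoid E] {C μ : ℝ} {f : E → ℝ}

theorem sum_range_le_of_succ_le_mul (hf : IsQuasiSubadditive C f) (hC : 1 ≤ C) (hf0 : f 0 = 0)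
    (hμ : 2 * C * μ ≤ 1) (n : ℕ) {x : ℕ → E} {z : ℕ → ℝ} (hz : ∀ i, 0 ≤ z i)
    (hx : ∀ i, f (x i) ≤ z i) (hzμ : ∀ i, z (i + 1) ≤ μ * z i) :
    f (∑ i ∈ Finset.range n, x i) ≤ 2 * C * z 0 := by
  induction n generalizing x z with
  | zero =>
    have := hz 0
    rw [Finset.sum_range_zero, hf0]
    positivity
  | succ n ih =>
    rw [Finset.sum_range_succ']
    have htail : f (∑ i ∈ Finset.range n, x (i + 1)) ≤ z 0 := calc
      _ ≤ 2 * C * z 1 := ih (fun i => hz (i + 1)) (fun i => hx (i + 1)) fun i => hzμ (i + 1)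
      _ ≤ 2 * C * (μ * z 0) := by gcongr; exact hzμ 0
      _ = 2 * C * μ * z 0 := by ring
      _ ≤ z 0 := mul_le_of_le_one_left (hz 0) hμ
    calc _ ≤ C * (f (∑ i ∈ Finset.range n, x (i + 1)) + f (x 0)) := hf _ _
      _ ≤ C * (z 0 + z 0) := by gcongr; exact hx 0
      _ = 2 * C * z 0 := by ring

theorem sum_range_succ_le_of_le_mul_succ (hf : IsQuasiSubadditive C f) (hC : 1 ≤ C)
    (hμ : 2 * C * μ ≤ 1) {x : ℕ → E} {z : ℕ → ℝ} (hz : ∀ i, 0 ≤ z i)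
    (hx : ∀ i, f (x i) ≤ z i) (hzμ : ∀ i, z i ≤ μ * z (i + 1)) (n : ℕ) :
    f (∑ i ∈ Finset.range (n + 1), x i) ≤ 2 * C * z n := by
  induction n with
  | zero =>
    rw [zero_add, Finset.sum_range_one]
    exact (hx 0).trans (le_mul_of_one_le_left (hz 0) (by linarith))
  | succ n ih =>
    rw [Finset.sum_range_succ]
    have hhead : f (∑ i ∈ Finset.range (n + 1), x i) ≤ z (n + 1) := calc
      _ ≤ 2 * C * z n := ih
      _ ≤ 2 * C * (μ * z (n + 1)) := by gcongr; exact hzμ n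
      _ = 2 * C * μ * z (n + 1) := by ring
      _ ≤ z (n + 1) := mul_le_of_le_one_left (hz _) hμ
    calc _ ≤ C * (f (∑ i ∈ Finset.range (n + 1), x i) + f (x (n + 1))) := hf _ _
      _ ≤ C * (z (n + 1) + z (n + 1)) := by gcongr; exact hx _
      _ = 2 * C * z (n + 1) := by ring

end IsQuasiSubadditive

namespace QuasiNorm

variable {𝕜 : Type*} [RCLike 𝕜] {E : Type*} [AddCommGroup E] [Module 𝕜 E]

section Basic

variable (N : QuasiNorm 𝕜 E)

protected theorem map_zero : N 0 = 0 := (N.eq_zero_iff' 0).2 rfl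

protected theorem map_neg (x : E) : N (-x) = N x := by
  simpa using N.smul' (-1) x

protected theorem map_sub_rev (x y : E) : N (x - y) = N (y - x) := by
  rw [← N.map_neg, neg_sub]

theorem map_ofReal_smul {r : ℝ} (hr : 0 ≤ r) (x : E) : N ((r : 𝕜) • x) = r * N x := by
  rw [N.smul', RCLike.norm_ofReal, abs_of_nonneg hr]

theorem pos_of_ne_zero {x : E} (hx : x ≠ 0) : 0 < N x :=
  (N.nonneg' x).lt_of_ne' fun h => hx ((N.eq_zero_iff' x).1 h)

variable {N} {C : ℝ}

theorem map_sub_le (hN : IsQuasiSubadditive C N) (x y : E) : N (x - y) ≤ C * (N x + N y) := by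
  simpa only [sub_eq_add_neg, N.map_neg] using hN x (-y)

theorem eq_of_tendsto_sub {u : ℕ → E} {x y : E} (hx : Tendsto (fun n => N (u n - x)) atTop (𝓝 0))
    (hy : Tendsto (fun n => N (u n - y)) atTop (𝓝 0)) : x = y := by
  obtain ⟨C, hC⟩ := N.exists_add_le'
  have hlim : Tendsto (fun n => C * (N (u n - y) + N (u n - x))) atTop (𝓝 0) := by
    simpa using (hy.add hx).const_mul C
  have hle : N (x - y) ≤ 0 := ge_of_tendsto' hlim fun n => by
    simpa using map_sub_le hC (u n - y) (u n - x)
  exact sub_eq_zero.1 ((N.eq_zero_iff' _).1 (hle.antisymm (N.nonneg' _)))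

theorem IsQuasiBanach.exists_sub_sum_range_le (hN : N.IsQuasiBanach)
    (hadd : IsQuasiSubadditive C N) (hC : 1 ≤ C) {μ : ℝ} (hμ0 : 0 ≤ μ) (hμ : 2 * C * μ ≤ 1)
    {w : ℕ → E} {z : ℕ → ℝ} (hz : ∀ n, 0 ≤ z n) (hw : ∀ n, N (w n) ≤ z n)
    (hzμ : ∀ n, z (n + 1) ≤ μ * z n) :
    ∃ x : E, ∀ n, N (x - ∑ i ∈ Finset.range n, w i) ≤ 2 * C ^ 2 * z n := by
  set S : ℕ → E := fun n => ∑ i ∈ Finset.range n, w i with hS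
  have hcauchy : ∀ n k, N (S (n + k) - S n) ≤ 2 * C * z n := fun n k => by
    simp only [hS, Finset.sum_range_add, add_sub_cancel_left]
    exact hadd.sum_range_le_of_succ_le_mul hC N.map_zero hμ k (fun i => hz (n + i))
      (fun i => hw (n + i)) fun i => hzμ (n + i)
  have hzlim : Tendsto (fun n => 2 * C * z n) atTop (𝓝 0) := by
    have hgeom : Tendsto (fun n => μ ^ n * z 0) atTop (𝓝 0) := by
      simpa using (tendsto_pow_atTop_nhds_zero_of_lt_one hμ0 (by nlinarith)).mul_const (z 0)
    simpa using (squeeze_zero hz (fun n => le_geom hμ0 n fun k _ => hzμ k) hgeom).const_mul (2 * C)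
  obtain ⟨x, hx⟩ := hN S fun ε hε => by
    obtain ⟨n₀, hn₀⟩ := eventually_atTop.1 (hzlim.eventually_lt_const hε)
    refine ⟨n₀, fun m n hm hn => ?_⟩
    wlog hnm : n ≤ m generalizing m n
    · rw [N.map_sub_rev]
      exact this n m hn hm (le_of_not_ge hnm)
    obtain ⟨k, rfl⟩ := Nat.exists_eq_add_of_le hnm
    exact (hcauchy n k).trans_lt (hn₀ n hn)
  refine ⟨x, fun n => ?_⟩
  have hlim : Tendsto (fun k => C * (N (S (n + k) - x) + 2 * C * z n)) atTop
      (𝓝 (C * (0 + 2 * C * z n))) :=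
    (((tendsto_add_atTop_iff_nat n).2 hx).congr fun k => by rw [add_comm k n]).add_const _
      |>.const_mul C
  calc N (x - S n) ≤ C * (0 + 2 * C * z n) := ge_of_tendsto' hlim fun k => by
        have h := hadd (x - S (n + k)) (S (n + k) - S n)
        rw [sub_add_sub_cancel, N.map_sub_rev x (S (n + k))] at h
        exact h.trans (by gcongr; exact hcauchy n k)
    _ = 2 * C ^ 2 * z n := by ring

end Basic

section Peetre

variable (NX : QuasiNorm 𝕜 E) {Y : Submodule 𝕜 E} (NY : QuasiNorm 𝕜 Y)

/-- `C` is a modulus of concavity of the couple `(NX, NY)`: a constant for which the quasi-triangle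
inequality holds in `X`, in `Y` and for every functional `K(·, t)`. -/
structure IsModulus (C : ℝ) : Prop where
  one_le : 1 ≤ C
  left : IsQuasiSubadditive C NX
  right : IsQuasiSubadditive C NY
  kFunctional {t : ℝ} (ht : 0 ≤ t) : IsQuasiSubadditive C fun x => peetreK NX NY x t

theorem exists_isModulus : ∃ C, IsModulus NX NY C := by
  obtain ⟨A, hA⟩ := NX.exists_add_le'
  obtain ⟨B, hB⟩ := NY.exists_add_le'
  obtain ⟨D, -, hD⟩ := exists_peetreK_add_le NX NY
  refine ⟨max 1 (max A (max B D)), le_max_left _ _, ?_, ?_, fun {t} ht => ?_⟩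
  · exact IsQuasiSubadditive.mono (C := A) hA (by simp) NX.nonneg'
  · exact IsQuasiSubadditive.mono (C := B) hB (by simp) NY.nonneg'
  · exact IsQuasiSubadditive.mono (C := D) (fun x y => hD x y t ht) (by simp)
      fun x => peetreK_nonneg NX NY x ht

/-- Peetre's `J`-functional `J(u, t) = max ‖u‖_X (t ‖u‖_Y)` on `Y`. -/
noncomputable def peetreJ (u : Y) (t : ℝ) : ℝ := max (NX (u : E)) (t * NY u)

theorem peetreJ_nonneg (u : Y) (t : ℝ) : 0 ≤ peetreJ NX NY u t :=
  le_max_of_le_left (NX.nonneg' _)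

theorem peetreJ_pos {u : Y} (hu : u ≠ 0) {t : ℝ} (ht : 0 < t) : 0 < peetreJ NX NY u t :=
  lt_max_of_lt_right (mul_pos ht (NY.pos_of_ne_zero hu))

theorem peetreJ_ofReal_smul {r : ℝ} (hr : 0 ≤ r) (u : Y) (t : ℝ) :
    peetreJ NX NY ((r : 𝕜) • u) t = r * peetreJ NX NY u t := by
  simp only [peetreJ, Submodule.coe_smul, map_ofReal_smul _ hr, mul_max_of_nonneg _ _ hr,
    mul_left_comm t r]

theorem peetreK_le (x : E) {t : ℝ} (ht : 0 ≤ t) (y : Y) :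
    peetreK NX NY x t ≤ NX (x - y) + t * NY y :=
  ciInf_le (peetreK_bdd NX NY x ht) y

theorem peetreK_le_left (x : E) {t : ℝ} (ht : 0 ≤ t) : peetreK NX NY x t ≤ NX x := by
  simpa [NY.map_zero] using peetreK_le NX NY x ht 0

theorem peetreK_le_right (y : Y) {t : ℝ} (ht : 0 ≤ t) : peetreK NX NY (y : E) t ≤ t * NY y := by
  simpa [NX.map_zero] using peetreK_le NX NY (y : E) ht y

theorem peetreK_mono (x : E) {t t' : ℝ} (ht : 0 ≤ t) (h : t ≤ t') :
    peetreK NX NY x t ≤ peetreK NX NY x t' :=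
  ciInf_mono (peetreK_bdd NX NY x ht) fun y =>
    add_le_add_right (mul_le_mul_of_nonneg_right h (NY.nonneg' y)) _

theorem exists_lt_of_peetreK_lt {x : E} {t r : ℝ} (h : peetreK NX NY x t < r) :
    ∃ y : Y, NX (x - y) + t * NY y < r :=
  exists_lt_of_ciInf_lt h

theorem peetreK_ofReal_smul {r : ℝ} (hr : 0 < r) (x : E) {t : ℝ} (ht : 0 ≤ t) :
    peetreK NX NY ((r : 𝕜) • x) t = r * peetreK NX NY x t := by
  have hle : ∀ {r : ℝ}, 0 < r → ∀ x : E,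
      peetreK NX NY ((r : 𝕜) • x) t ≤ r * peetreK NX NY x t := fun {r} hr x => by
    simpa only [RCLike.norm_ofReal, abs_of_pos hr] using peetreK_smul_le NX NY (r : 𝕜) x ht
  refine (hle hr x).antisymm ((le_inv_mul_iff₀ hr).1 ?_)
  have h := hle (inv_pos.2 hr) ((r : 𝕜) • x)
  rwa [smul_smul, ← RCLike.ofReal_mul, inv_mul_cancel₀ hr.ne', RCLike.ofReal_one, one_smul] at h

theorem peetreK_neg_le (x : E) {t : ℝ} (ht : 0 ≤ t) :
    peetreK NX NY (-x) t ≤ peetreK NX NY x t := by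
  simpa using peetreK_smul_le NX NY (-1 : 𝕜) x ht

theorem peetreK_le_min_mul_peetreJ (u : Y) {s t : ℝ} (hs : 0 ≤ s) (ht : 0 < t) :
    peetreK NX NY (u : E) s ≤ min 1 (s / t) * peetreJ NX NY u t := by
  rw [min_mul_of_nonneg _ _ (peetreJ_nonneg NX NY u t), one_mul]
  refine le_min ((peetreK_le_left NX NY _ hs).trans (le_max_left _ _)) ?_
  calc _ ≤ s * NY u := peetreK_le_right NX NY u hs
    _ = s / t * (t * NY u) := by field_simp
    _ ≤ _ := by gcongr; exact le_max_right _ _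

theorem peetreK_sq_le_mul_peetreJ (u : Y) (σ : ℝ) {τ : ℝ} (hτ : 0 < τ) :
    peetreK NX NY (u : E) (σ ^ 2) ≤ σ / τ * min 1 (σ / τ) * peetreJ NX NY u (τ ^ 2) := by
  refine (peetreK_le_min_mul_peetreJ NX NY u (sq_nonneg σ) (sq_pos_of_pos hτ)).trans ?_
  refine mul_le_mul_of_nonneg_right ?_ (peetreJ_nonneg NX NY u _)
  rw [← div_pow]
  rcases le_total 1 (σ / τ) with h1 | h1
  · rw [min_eq_left h1, mul_one]
    exact (min_le_left _ _).trans h1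
  · rw [min_eq_right h1, ← sq]
    exact min_le_right _ _

end Peetre

section NotClosed

variable {NX : QuasiNorm 𝕜 E} {Y : Submodule 𝕜 E} {NY : QuasiNorm 𝕜 Y} {C : ℝ}

theorem IsModulus.exists_peetreJ_le (hC : IsModulus NX NY C) {ε t : ℝ} (hε0 : 0 < ε) (hε1 : ε ≤ 1)
    (ht : 0 < t) {u : Y} (hu : peetreK NX NY (u : E) t < ε * peetreJ NX NY u t) :
    ∃ y : Y, peetreJ NX NY (u - y) (ε * t) ≤ 2 * C * ε * peetreJ NX NY u t ∧
      peetreJ NX NY y (t / ε) ≤ 2 * C * peetreJ NX NY u t := by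
  have hC1 := hC.one_le
  obtain ⟨y, hy⟩ := exists_lt_of_peetreK_lt NX NY hu
  set J := peetreJ NX NY u t
  have hJ : 0 ≤ J := peetreJ_nonneg NX NY u t
  have hXu : NX (u : E) ≤ J := le_max_left _ _
  have hYu : t * NY u ≤ J := le_max_right _ _
  have hεJ : ε * J ≤ J := mul_le_of_le_one_left hJ hε1
  have hX : NX ((u : E) - y) ≤ ε * J := by linarith [mul_nonneg ht.le (NY.nonneg' y)]
  have hY : t * NY y ≤ ε * J := by linarith [NX.nonneg' ((u : E) - y)]
  refine ⟨y, max_le ?_ ?_, max_le ?_ ?_⟩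
  · calc NX ((u - y : Y) : E) ≤ 1 * (ε * J) := by simpa using hX
      _ ≤ 2 * C * (ε * J) := by gcongr; linarith
      _ = _ := by ring
  · calc ε * t * NY (u - y) ≤ ε * t * (C * (NY u + NY y)) := by
          gcongr; exact map_sub_le hC.right u y
      _ = C * ε * (t * NY u + t * NY y) := by ring
      _ ≤ C * ε * (J + J) := by gcongr; exact hY.trans hεJ
      _ = _ := by ring
  · calc NX (y : E) ≤ C * (NX (u : E) + NX ((u : E) - y)) := by
          simpa using map_sub_le hC.left (u : E) (u - y)
      _ ≤ C * (J + J) := by gcongr; exact hX.trans hεJ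
      _ = _ := by ring
  · calc t / ε * NY y = t * NY y / ε := by ring
      _ ≤ J := (div_le_iff₀' hε0).2 hY
      _ ≤ _ := le_mul_of_one_le_left hJ (by linarith)

-- Every application of the splitting replaces the scale `τ²` by `(eτ)²` and `(τ/e)²`, and the
-- weight `1/τ` makes the two pieces contribute equally.
theorem IsModulus.peetreK_sq_le_max (hC : IsModulus NX NY C) {e T : ℝ} (he0 : 0 < e)
    (he : 8 * C ^ 2 * e ≤ 1) (hT : 0 < T)
    (h : ∀ τ, 0 < τ → τ < T → ∀ u : Y, u ≠ 0 →
      peetreK NX NY (u : E) (τ ^ 2) < e ^ 2 * peetreJ NX NY u (τ ^ 2))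
    {σ : ℝ} (hσ : 0 < σ) (k : ℕ) {τ : ℝ} (hτ : 0 < τ) (u : Y) :
    peetreK NX NY (u : E) (σ ^ 2) ≤
      σ / τ * max ((1 / 2) ^ k) (σ / T) * peetreJ NX NY u (τ ^ 2) := by
  have hC1 := hC.one_le
  have he1 : e ^ 2 ≤ 1 := pow_le_one₀ he0.le (by nlinarith)
  induction k generalizing τ u with
  | zero =>
    refine (peetreK_sq_le_mul_peetreJ NX NY u σ hτ).trans ?_
    have := peetreJ_nonneg NX NY u (τ ^ 2)
    gcongr
    exact (min_le_left _ _).trans (by simp)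
  | succ k ih =>
    have hJ := peetreJ_nonneg NX NY u (τ ^ 2)
    rcases le_or_gt T τ with hTτ | hτT
    · refine (peetreK_sq_le_mul_peetreJ NX NY u σ hτ).trans ?_
      gcongr
      exact (min_le_right _ _).trans (le_max_of_le_right (by gcongr))
    rcases eq_or_ne u 0 with rfl | hu
    · rw [Submodule.coe_zero, peetreK_zero NX NY (sq_nonneg σ)]
      positivity
    obtain ⟨y, hsmall, hlarge⟩ :=
      hC.exists_peetreJ_le (by positivity) he1 (by positivity) (h τ hτ hτT u hu)
    rw [← mul_pow] at hsmall
    rw [← div_pow] at hlarge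
    set J := peetreJ NX NY u (τ ^ 2)
    set b := max ((1 / 2) ^ k) (σ / T)
    calc peetreK NX NY (u : E) (σ ^ 2)
        ≤ C * (peetreK NX NY ((u - y : Y) : E) (σ ^ 2) + peetreK NX NY (y : E) (σ ^ 2)) := by
          simpa using hC.kFunctional (sq_nonneg σ) ((u : E) - y) y
      _ ≤ C * (σ / (e * τ) * b * (2 * C * e ^ 2 * J) + σ / (τ / e) * b * (2 * C * J)) := by
          gcongr
          · exact (ih (by positivity) _).trans (mul_le_mul_of_nonneg_left hsmall (by positivity))
          · exact (ih (by positivity) _).trans (mul_le_mul_of_nonneg_left hlarge (by positivity))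
      _ = 8 * C ^ 2 * e * (σ / τ * (b / 2) * J) := by field_simp; ring
      _ ≤ σ / τ * (b / 2) * J := mul_le_of_le_one_left (by positivity) he
      _ ≤ _ := by
          gcongr
          rw [← max_div_div_right (by norm_num : (0 : ℝ) ≤ 2), pow_succ]
          exact max_le_max (by linarith) (half_le_self (by positivity))

theorem IsModulus.peetreK_sq_le (hC : IsModulus NX NY C) {e T : ℝ} (he0 : 0 < e)
    (he : 8 * C ^ 2 * e ≤ 1) (hT : 0 < T)
    (h : ∀ τ, 0 < τ → τ < T → ∀ u : Y, u ≠ 0 →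
      peetreK NX NY (u : E) (τ ^ 2) < e ^ 2 * peetreJ NX NY u (τ ^ 2))
    {σ τ : ℝ} (hσ : 0 < σ) (hτ : 0 < τ) (u : Y) :
    peetreK NX NY (u : E) (σ ^ 2) ≤ σ / τ * (σ / T) * peetreJ NX NY u (τ ^ 2) := by
  obtain ⟨k, hk⟩ := exists_pow_lt_of_lt_one (div_pos hσ hT) (by norm_num : (1 / 2 : ℝ) < 1)
  simpa only [max_eq_right hk.le] using hC.peetreK_sq_le_max he0 he hT h hσ k hτ u

theorem exists_approx_of_peetreK_le {u : E} (hu : u ≠ 0) {G : ℝ} (hG0 : 0 ≤ G)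
    (hG : ∀ s, 0 < s → peetreK NX NY u s ≤ s * G) {δ : ℝ} (hδ : 0 < δ) :
    ∃ w : Y, NX (u - w) ≤ NX u * δ ∧ NY w ≤ G + NX u := by
  have ha := NX.pos_of_ne_zero hu
  set a := NX u
  set r := a * δ / (G + a) with hr
  have hr0 : 0 < r := by positivity
  have hrG : r * (G + a) = a * δ := by rw [hr]; field_simp
  obtain ⟨w, hw⟩ := exists_lt_of_peetreK_lt NX NY (x := u) (t := r) (r := r * (G + a))
    ((hG r hr0).trans_lt (by gcongr; linarith))
  refine ⟨w, by linarith [mul_nonneg hr0.le (NY.nonneg' w)], ?_⟩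
  exact le_of_mul_le_mul_left (by linarith [NX.nonneg' (u - w)]) hr0

theorem IsModulus.peetreK_le_improve (hC : IsModulus NX NY C) {T : ℝ} (hT : 0 < T)
    (h : ∀ σ τ, 0 < σ → 0 < τ → ∀ w : Y,
      peetreK NX NY (w : E) (σ ^ 2) ≤ σ / τ * (σ / T) * peetreJ NX NY w (τ ^ 2))
    {u : Y} {G : ℝ} (hG0 : 0 ≤ G) (hG : ∀ s, 0 < s → peetreK NX NY (u : E) s ≤ s * G)
    {s : ℝ} (hs : 0 < s) :
    peetreK NX NY (u : E) s ≤ s * ((C + 4 * C ^ 3 / T ^ 2 + 1 / 2) * NX (u : E) + G / 2) := by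
  have hC1 := hC.one_le
  have hu0 := NX.nonneg' (u : E)
  rcases eq_or_ne u 0 with rfl | hu
  · rw [Submodule.coe_zero, peetreK_zero NX NY hs.le]
    positivity
  set a := NX (u : E)
  obtain ⟨w, hwX, hwY⟩ := exists_approx_of_peetreK_le (fun h0 => hu (Subtype.ext h0)) hG0 hG
    (lt_min hs one_pos)
  have hwX2 : NX (w : E) ≤ 2 * C * a := calc
    NX (w : E) ≤ C * (a + NX ((u : E) - w)) := by
      simpa using map_sub_le hC.left (u : E) (u - w)
    _ ≤ C * (a + a * 1) := by gcongr; exact hwX.trans (by gcongr; exact min_le_right _ _)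
    _ = 2 * C * a := by ring
  have hKw : peetreK NX NY (w : E) s ≤ s * (2 * C / T ^ 2 * NX (w : E) + NY w / (2 * C)) := by
    have hsq := h √s (T / (2 * C)) (Real.sqrt_pos.2 hs) (by positivity) w
    rw [Real.sq_sqrt hs.le] at hsq
    refine hsq.trans ?_
    calc _ ≤ √s / (T / (2 * C)) * (√s / T) * (NX (w : E) + (T / (2 * C)) ^ 2 * NY w) := by
          gcongr
          exact max_le_add_of_nonneg (NX.nonneg' _) (mul_nonneg (sq_nonneg _) (NY.nonneg' w))
      _ = √s ^ 2 * (2 * C / T ^ 2 * NX (w : E) + NY w / (2 * C)) := by field_simp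
      _ = _ := by rw [Real.sq_sqrt hs.le]
  calc peetreK NX NY (u : E) s
      ≤ C * (peetreK NX NY ((u : E) - w) s + peetreK NX NY (w : E) s) := by
        simpa using hC.kFunctional hs.le ((u : E) - w) w
    _ ≤ C * (a * s + s * (2 * C / T ^ 2 * (2 * C * a) + (G + a) / (2 * C))) := by
        gcongr
        · exact (peetreK_le_left NX NY _ hs.le).trans
            (hwX.trans (by gcongr; exact min_le_left _ _))
        · exact hKw.trans (by gcongr)
    _ = _ := by field_simp; ring

theorem IsModulus.peetreK_le_mul_left (hC : IsModulus NX NY C) {T : ℝ} (hT : 0 < T)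
    (h : ∀ σ τ, 0 < σ → 0 < τ → ∀ w : Y,
      peetreK NX NY (w : E) (σ ^ 2) ≤ σ / τ * (σ / T) * peetreJ NX NY w (τ ^ 2))
    (u : Y) {s : ℝ} (hs : 0 < s) :
    peetreK NX NY (u : E) s ≤ s * (2 * (C + 4 * C ^ 3 / T ^ 2 + 1 / 2) * NX (u : E)) := by
  have hC1 := hC.one_le
  have hX := NX.nonneg' (u : E)
  have hY := NY.nonneg' u
  set D := C + 4 * C ^ 3 / T ^ 2 + 1 / 2
  have hstep : ∀ n : ℕ, ∀ s, 0 < s →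
      peetreK NX NY (u : E) s ≤ s * (2 * D * NX (u : E) + (1 / 2) ^ n * NY u) := fun n => by
    induction n with
    | zero =>
      intro s hs
      refine (peetreK_le_right NX NY u hs.le).trans ?_
      gcongr
      rw [pow_zero, one_mul]
      exact le_add_of_nonneg_left (by positivity)
    | succ n ih =>
      intro s hs
      exact (hC.peetreK_le_improve hT h (by positivity) ih hs).trans_eq (by ring)
  have hlim : Tendsto (fun n : ℕ => s * (2 * D * NX (u : E) + (1 / 2) ^ n * NY u)) atTop
      (𝓝 (s * (2 * D * NX (u : E) + 0 * NY u))) :=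
    (((tendsto_pow_atTop_nhds_zero_of_lt_one (by norm_num) (by norm_num)).mul_const _).const_add
      _).const_mul s
  simpa using ge_of_tendsto' hlim fun n => hstep n s hs

theorem ContinuouslyEmbedded.tendsto_sub (hYX : NX.ContinuouslyEmbedded NY) {v : ℕ → Y} {y : Y}
    (hv : Tendsto (fun n => NY (v n - y)) atTop (𝓝 0)) :
    Tendsto (fun n => NX ((v n : E) - y)) atTop (𝓝 0) := by
  obtain ⟨M, hM⟩ := hYX
  exact squeeze_zero (fun n => NX.nonneg' _) (fun n => hM (v n - y))
    (by simpa using hv.const_mul M)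

-- Iterating the approximation expands `u` into a series converging in `Y`.
theorem IsModulus.right_le_of_approx (hC : IsModulus NX NY C) (hY : NY.IsQuasiBanach)
    (hYX : NX.ContinuouslyEmbedded NY) {μ B : ℝ} (hμ0 : 0 ≤ μ) (hμ : 2 * C * μ ≤ 1) (hB : 0 ≤ B)
    (h : ∀ u : Y, ∃ w : Y, NX ((u : E) - w) ≤ μ * NX (u : E) ∧ NY w ≤ B * NX (u : E)) (u : Y) :
    NY u ≤ 2 * C ^ 2 * B * NX (u : E) := by
  have hC1 := hC.one_le
  choose W hWX hWY using h
  let r : ℕ → Y := fun n => (fun v => v - W v)^[n] u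
  have hr : ∀ n, r (n + 1) = r n - W (r n) := fun n => Function.iterate_succ_apply' _ n u
  have hrX : ∀ n, NX (r n : E) ≤ μ ^ n * NX (u : E) := fun n =>
    le_geom (u := fun n => NX (r n : E)) hμ0 n fun k _ => by
      simpa only [hr, Submodule.coe_sub] using hWX (r k)
  have hsum : ∀ n, ∑ i ∈ Finset.range n, W (r i) = u - r n := fun n => by
    rw [show u - r n = r 0 - r n from rfl, ← Finset.sum_range_sub' r n]
    exact Finset.sum_congr rfl fun i _ => by rw [hr, sub_sub_cancel]
  have hz : ∀ n, 0 ≤ B * (μ ^ n * NX (u : E)) := fun n => by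
    have := NX.nonneg' (u : E)
    positivity
  obtain ⟨y, hy⟩ := hY.exists_sub_sum_range_le hC.right hC1 hμ0 hμ hz
    (fun n => (hWY (r n)).trans (mul_le_mul_of_nonneg_left (hrX n) hB))
    fun n => (by ring : B * (μ ^ (n + 1) * NX (u : E)) = μ * (B * (μ ^ n * NX (u : E)))).le
  simp only [hsum] at hy
  have hgeom : Tendsto (fun n : ℕ => μ ^ n * NX (u : E)) atTop (𝓝 0) := by
    simpa using (tendsto_pow_atTop_nhds_zero_of_lt_one hμ0 (by nlinarith)).mul_const (NX (u : E))
  have hlimY : Tendsto (fun n => NY (u - r n - y)) atTop (𝓝 0) := by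
    refine squeeze_zero (fun n => NY.nonneg' _) (fun n => ?_)
      (by simpa using (hgeom.const_mul B).const_mul (2 * C ^ 2))
    rw [NY.map_sub_rev]
    exact hy n
  have hlimX : Tendsto (fun n => NX (((u - r n : Y) : E) - u)) atTop (𝓝 0) := by
    refine squeeze_zero (fun n => NX.nonneg' _) (fun n => ?_) hgeom
    rw [NX.map_sub_rev, Submodule.coe_sub, sub_sub_cancel]
    exact hrX n
  have hyu : y = u := Subtype.ext (eq_of_tendsto_sub (hYX.tendsto_sub hlimY) hlimX)
  have h0 := hy 0
  simp only [show r 0 = u from rfl, sub_self, sub_zero, pow_zero, one_mul, hyu] at h0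
  linarith

theorem isClosedSet_of_right_le (hY : NY.IsQuasiBanach) (hYX : NX.ContinuouslyEmbedded NY) {D : ℝ}
    (hD : ∀ u : Y, NY u ≤ D * NX (u : E)) : NX.IsClosedSet (Y : Set E) := by
  intro v x hv hx
  obtain ⟨C, hC⟩ := NX.exists_add_le'
  lift v to ℕ → Y using hv
  have hlim : Tendsto (fun p : ℕ × ℕ => max D 0 * (C * (NX (v p.1 - x) + NX (v p.2 - x)))) atTop
      (𝓝 0) := by
    rw [← prod_atTop_atTop_eq]
    simpa using (((hx.comp tendsto_fst).add (hx.comp tendsto_snd)).const_mul C).const_mul (max D 0)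
  obtain ⟨y, hy⟩ := hY v fun ε hε => by
    obtain ⟨n₀, hn₀⟩ := eventually_atTop_prod_self.1 (hlim.eventually_lt_const hε)
    refine ⟨n₀, fun m n hm hn => lt_of_le_of_lt ?_ (hn₀ m n hm hn)⟩
    calc NY (v m - v n) ≤ D * NX ((v m : E) - v n) := hD (v m - v n)
      _ ≤ max D 0 * NX ((v m : E) - v n) := by
          gcongr
          exacts [NX.nonneg' _, le_max_left _ _]
      _ ≤ _ := by
          gcongr
          simpa using map_sub_le hC ((v m : E) - x) (v n - x)
  rw [eq_of_tendsto_sub hx (hYX.tendsto_sub hy)]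
  exact y.2

theorem isClosedSet_of_peetreK_le (hY : NY.IsQuasiBanach) (hYX : NX.ContinuouslyEmbedded NY)
    {D : ℝ} (hD0 : 0 ≤ D)
    (hD : ∀ (u : Y) (s : ℝ), 0 < s → peetreK NX NY (u : E) s ≤ s * (D * NX (u : E))) :
    NX.IsClosedSet (Y : Set E) := by
  obtain ⟨C, hC⟩ := exists_isModulus NX NY
  have hC1 := hC.one_le
  have hμ : 2 * C * (1 / (2 * C)) = 1 := by field_simp
  refine isClosedSet_of_right_le hY hYX (hC.right_le_of_approx hY hYX (B := D + 1)
    (by positivity) hμ.le (by positivity) fun u => ?_)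
  rcases eq_or_ne u 0 with rfl | hu
  · exact ⟨0, by simp [NX.map_zero, NY.map_zero]⟩
  obtain ⟨w, hwX, hwY⟩ := exists_approx_of_peetreK_le (δ := 1 / (2 * C))
    (fun h0 => hu (Subtype.ext h0)) (mul_nonneg hD0 (NX.nonneg' _)) (hD u) (by positivity)
  exact ⟨w, hwX.trans_eq (mul_comm _ _), by linarith⟩

/-- At arbitrarily small scales `t` there are vectors of `Y` for which `K(u, t)` is comparable, with
constant `c`, to its trivial upper bound `J(u, t)`, here normalised to be at most `1`. -/
def HasExtremalVectors (NX : QuasiNorm 𝕜 E) {Y : Submodule 𝕜 E} (NY : QuasiNorm 𝕜 Y) (c : ℝ) :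
    Prop :=
  ∀ T > 0, ∃ t, 0 < t ∧ t < T ∧ ∃ u : Y, peetreJ NX NY u t ≤ 1 ∧ c ≤ peetreK NX NY (u : E) t

theorem exists_hasExtremalVectors_of_not_isClosedSet (hY : NY.IsQuasiBanach)
    (hYX : NX.ContinuouslyEmbedded NY) (hclosed : ¬ NX.IsClosedSet (Y : Set E)) :
    ∃ c > 0, HasExtremalVectors NX NY c := by
  obtain ⟨C, hC⟩ := exists_isModulus NX NY
  have hC1 := hC.one_le
  set e := 1 / (8 * C ^ 2) with he
  have he0 : 0 < e := by positivity
  refine ⟨e ^ 2, by positivity, fun T hT => ?_⟩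
  obtain ⟨τ, hτ0, hτT, u, hu, hKJ⟩ : ∃ τ, 0 < τ ∧ τ < min T 1 ∧ ∃ u : Y, u ≠ 0 ∧
      e ^ 2 * peetreJ NX NY u (τ ^ 2) ≤ peetreK NX NY (u : E) (τ ^ 2) := by
    by_contra! h
    have hT' : 0 < min T 1 := lt_min hT one_pos
    have hK := fun (σ τ : ℝ) (hσ : 0 < σ) (hτ : 0 < τ) (w : Y) =>
      hC.peetreK_sq_le he0 (by rw [he]; field_simp; rfl) hT' h hσ hτ w
    exact hclosed (isClosedSet_of_peetreK_le hY hYX (by positivity) fun u s hs =>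
      hC.peetreK_le_mul_left hT' hK u hs)
  have hJ : 0 < peetreJ NX NY u (τ ^ 2) := peetreJ_pos NX NY hu (by positivity)
  refine ⟨τ ^ 2, by positivity, ?_, (((peetreJ NX NY u (τ ^ 2))⁻¹ : ℝ) : 𝕜) • u, ?_, ?_⟩
  · have hτ1 := hτT.trans_le (min_le_right T 1)
    nlinarith [hτT.trans_le (min_le_left T 1)]
  · rw [peetreJ_ofReal_smul NX NY (by positivity), inv_mul_cancel₀ hJ.ne']
  · rw [Submodule.coe_smul, peetreK_ofReal_smul NX NY (by positivity) _ (by positivity),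
      ← div_eq_inv_mul, le_div_iff₀ hJ]
    exact hKJ

end NotClosed

section Lacunary

variable {NX : QuasiNorm 𝕜 E} {Y : Submodule 𝕜 E} {NY : QuasiNorm 𝕜 Y} {C c μ : ℝ} {b t : ℕ → ℝ}
  {u : ℕ → Y} {x : E}

/-- Extremal vectors `u n` at scales `t n` with weights `b n` such that the upper bounds
`b n * min 1 (s / t n)` for `K(b n • u n, s)` vary geometrically, with ratio `μ`, on either side of
the index where `t n` is of the size of `s`. -/
structure IsLacunary (NX : QuasiNorm 𝕜 E) {Y : Submodule 𝕜 E} (NY : QuasiNorm 𝕜 Y) (c μ : ℝ)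
    (b t : ℕ → ℝ) (u : ℕ → Y) : Prop where
  weight_pos : ∀ n, 0 < b n
  scale_pos : ∀ n, 0 < t n
  peetreJ_le : ∀ n, peetreJ NX NY (u n) (t n) ≤ 1
  le_peetreK : ∀ n, c ≤ peetreK NX NY (u n : E) (t n)
  weight_succ_le : ∀ n, b (n + 1) ≤ μ * b n
  div_scale_le : ∀ n, b n / t n ≤ μ * (b (n + 1) / t (n + 1))

namespace IsLacunary

theorem peetreK_smul_le (h : IsLacunary NX NY c μ b t u) (n : ℕ) {s : ℝ} (hs : 0 ≤ s) :
    peetreK NX NY ((b n : 𝕜) • (u n : E)) s ≤ b n * min 1 (s / t n) := by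
  have hb := h.weight_pos n
  have ht := h.scale_pos n
  rw [peetreK_ofReal_smul NX NY hb _ hs]
  gcongr
  calc _ ≤ min 1 (s / t n) * peetreJ NX NY (u n) (t n) := peetreK_le_min_mul_peetreJ NX NY _ hs ht
    _ ≤ min 1 (s / t n) * 1 := by gcongr; exact h.peetreJ_le n
    _ = _ := mul_one _

theorem left_smul_le (h : IsLacunary NX NY c μ b t u) (n : ℕ) :
    NX ((b n : 𝕜) • (u n : E)) ≤ b n := by
  rw [map_ofReal_smul _ (h.weight_pos n).le]
  exact mul_le_of_le_one_right (h.weight_pos n).le ((le_max_left _ _).trans (h.peetreJ_le n))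

theorem exists_sub_sum_range_le (h : IsLacunary NX NY c μ b t u) (hC : IsModulus NX NY C)
    (hX : NX.IsQuasiBanach) (hμ0 : 0 ≤ μ) (hμ : 2 * C * μ ≤ 1) :
    ∃ x : E, ∀ n, NX (x - ∑ i ∈ Finset.range n, (b i : 𝕜) • (u i : E)) ≤ 2 * C ^ 2 * b n :=
  hX.exists_sub_sum_range_le hC.left hC.one_le hμ0 hμ (fun n => (h.weight_pos n).le)
    h.left_smul_le h.weight_succ_le

theorem peetreK_sum_range_succ_le (h : IsLacunary NX NY c μ b t u) (hC : IsModulus NX NY C)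
    (hμ : 2 * C * μ ≤ 1) {s : ℝ} (hs : 0 ≤ s) (n : ℕ) :
    peetreK NX NY (∑ i ∈ Finset.range (n + 1), (b i : 𝕜) • (u i : E)) s ≤
      2 * C * (b n * (s / t n)) := by
  refine (hC.kFunctional hs).sum_range_succ_le_of_le_mul_succ hC.one_le hμ
    (z := fun i => b i * (s / t i)) (fun i => ?_) (fun i => ?_) (fun i => ?_) n
  · have := h.weight_pos i
    have := h.scale_pos i
    positivity
  · exact (h.peetreK_smul_le i hs).trans
      (mul_le_mul_of_nonneg_left (min_le_right _ _) (h.weight_pos i).le)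
  · calc b i * (s / t i) = b i / t i * s := by ring
      _ ≤ μ * (b (i + 1) / t (i + 1)) * s := by gcongr; exact h.div_scale_le i
      _ = _ := by ring

theorem peetreK_sum_range_scale_le (h : IsLacunary NX NY c μ b t u) (hC : IsModulus NX NY C)
    (hμ0 : 0 ≤ μ) (hμ : 2 * C * μ ≤ 1) (n : ℕ) :
    peetreK NX NY (∑ i ∈ Finset.range n, (b i : 𝕜) • (u i : E)) (t n) ≤ 2 * C * μ * b n := by
  have hC1 := hC.one_le
  have hb := h.weight_pos n
  have ht := h.scale_pos n
  cases n with
  | zero =>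
    rw [Finset.sum_range_zero, peetreK_zero NX NY ht.le]
    positivity
  | succ n =>
    calc _ ≤ 2 * C * (b n * (t (n + 1) / t n)) := h.peetreK_sum_range_succ_le hC hμ ht.le n
      _ = 2 * C * t (n + 1) * (b n / t n) := by ring
      _ ≤ 2 * C * t (n + 1) * (μ * (b (n + 1) / t (n + 1))) := by gcongr; exact h.div_scale_le n
      _ = _ := by field_simp

-- At the scale `t n` the `n`-th term dominates both the terms before it and the terms after it.
theorem le_peetreK_of_sub_sum_range_le (h : IsLacunary NX NY c μ b t u) (hC : IsModulus NX NY C)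
    (hμ0 : 0 ≤ μ) (hμ : 2 * C * μ ≤ 1) (hμc : 8 * C ^ 4 * μ ≤ c)
    (hx : ∀ n, NX (x - ∑ i ∈ Finset.range n, (b i : 𝕜) • (u i : E)) ≤ 2 * C ^ 2 * b n) (n : ℕ) :
    c / (2 * C) * b n ≤ peetreK NX NY x (t n) := by
  have hC1 := hC.one_le
  have hb := h.weight_pos n
  have ht := (h.scale_pos n).le
  have hhead := h.peetreK_sum_range_scale_le hC hμ0 hμ n
  set S : ℕ → E := fun n => ∑ i ∈ Finset.range n, (b i : 𝕜) • (u i : E) with hS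
  have hterm : (b n : 𝕜) • (u n : E) = x + -(S n + (x - S (n + 1))) := by
    simp only [hS, Finset.sum_range_succ]
    abel
  have htail : peetreK NX NY (x - S (n + 1)) (t n) ≤ 2 * C ^ 2 * μ * b n := calc
    _ ≤ 2 * C ^ 2 * b (n + 1) := (peetreK_le_left NX NY _ ht).trans (hx (n + 1))
    _ ≤ 2 * C ^ 2 * (μ * b n) := by gcongr; exact h.weight_succ_le n
    _ = _ := by ring
  have hrest : peetreK NX NY (-(S n + (x - S (n + 1)))) (t n) ≤ c / (2 * C) * b n := calc
    _ ≤ peetreK NX NY (S n + (x - S (n + 1))) (t n) := peetreK_neg_le NX NY _ ht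
    _ ≤ C * (2 * C * μ * b n + 2 * C ^ 2 * μ * b n) :=
        (hC.kFunctional ht _ _).trans (by gcongr)
    _ = 2 * C ^ 2 * μ * (1 + C) * b n := by ring
    _ ≤ 2 * C ^ 2 * μ * (C + C) * b n := by gcongr
    _ = 8 * C ^ 4 * μ * (b n / (2 * C)) := by field_simp; ring
    _ ≤ c * (b n / (2 * C)) := by gcongr
    _ = _ := by ring
  have hsplit : c * b n ≤ C * (peetreK NX NY x (t n) + c / (2 * C) * b n) := calc
    c * b n ≤ peetreK NX NY ((b n : 𝕜) • (u n : E)) (t n) := by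
      rw [peetreK_ofReal_smul NX NY hb _ ht, mul_comm]
      gcongr
      exact h.le_peetreK n
    _ ≤ _ := by
      rw [hterm]
      exact (hC.kFunctional ht _ _).trans (by gcongr)
  refine le_of_mul_le_mul_left ?_ (by positivity : 0 < C)
  have hhalf : C * (c / (2 * C) * b n) = c * b n / 2 := by field_simp
  linarith

theorem peetreK_le_max_of_sub_sum_range_le (h : IsLacunary NX NY c μ b t u)
    (hC : IsModulus NX NY C) (hμ : 2 * C * μ ≤ 1)
    (hx : ∀ n, NX (x - ∑ i ∈ Finset.range n, (b i : 𝕜) • (u i : E)) ≤ 2 * C ^ 2 * b n) {s : ℝ}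
    (hs : 0 ≤ s) (n : ℕ) :
    peetreK NX NY x s ≤ 4 * C ^ 3 * max (b n * (s / t n)) (b (n + 1)) := by
  have hC1 := hC.one_le
  have hhead := h.peetreK_sum_range_succ_le hC hμ hs n
  have htail := (peetreK_le_left NX NY _ hs).trans (hx (n + 1))
  set S := ∑ i ∈ Finset.range (n + 1), (b i : 𝕜) • (u i : E)
  set B := max (b n * (s / t n)) (b (n + 1))
  have hB : 0 ≤ B := le_max_of_le_right (h.weight_pos _).le
  calc peetreK NX NY x s ≤ C * (peetreK NX NY S s + peetreK NX NY (x - S) s) := by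
        simpa using hC.kFunctional hs S (x - S)
    _ ≤ C * (2 * C * (b n * (s / t n)) + 2 * C ^ 2 * b (n + 1)) := by gcongr
    _ ≤ C * (2 * C * B + 2 * C ^ 2 * B) := by
        gcongr
        exacts [le_max_left _ _, le_max_right _ _]
    _ = 2 * C ^ 2 * (1 + C) * B := by ring
    _ ≤ 2 * C ^ 2 * (C + C) * B := by gcongr
    _ = 4 * C ^ 3 * B := by ring

theorem exists_peetreK_le_of_sub_sum_range_le (h : IsLacunary NX NY c μ b t u)
    (hC : IsModulus NX NY C) (hμ : 2 * C * μ ≤ 1) (ht0 : Tendsto t atTop (𝓝 0))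
    (hx : ∀ n, NX (x - ∑ i ∈ Finset.range n, (b i : 𝕜) • (u i : E)) ≤ 2 * C ^ 2 * b n)
    {s : ℝ} (hs : 0 < s) : ∃ m, peetreK NX NY x s ≤ 4 * C ^ 3 * (b m * min 1 (s / t m)) := by
  have hC1 := hC.one_le
  have hfirst : ∃ n, t n ≤ s := (ht0.eventually_le_const hs).exists
  have hone : ∀ n, t n ≤ s → min 1 (s / t n) = 1 := fun n hn =>
    min_eq_left ((one_le_div (h.scale_pos n)).2 hn)
  classical
  rcases hn : Nat.find hfirst with _ | n
  · have hts : t 0 ≤ s := hn ▸ Nat.find_spec hfirst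
    have hb := h.weight_pos 0
    refine ⟨0, ?_⟩
    calc peetreK NX NY x s ≤ NX x := peetreK_le_left NX NY x hs.le
      _ ≤ 2 * C ^ 2 * b 0 := by simpa using hx 0
      _ ≤ 4 * C ^ 3 * b 0 := by gcongr <;> norm_num
      _ = _ := by rw [hone 0 hts, mul_one]
  · have hts : t (n + 1) ≤ s := hn ▸ Nat.find_spec hfirst
    have hst : s / t n ≤ 1 :=
      (div_le_one (h.scale_pos n)).2 (not_le.1 (Nat.find_min hfirst (hn ▸ n.lt_succ_self))).le
    have hK := h.peetreK_le_max_of_sub_sum_range_le hC hμ hx hs.le n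
    rcases max_choice (b n * (s / t n)) (b (n + 1)) with hmax | hmax
    · exact ⟨n, by rwa [min_eq_right hst, ← hmax]⟩
    · exact ⟨n + 1, by rwa [hone _ hts, mul_one, ← hmax]⟩

end IsLacunary

theorem HasExtremalVectors.exists_isLacunary (hext : HasExtremalVectors NX NY c) {a : ℕ → ℝ}
    (ha : ∀ n, 0 < a n) {A : ℝ} (haA : ∀ n, a (n + 1) ≤ A * a n) (haA' : ∀ n, a n ≤ A * a (n + 1))
    {θ : ℝ} (hθ : θ ∈ Set.Ioo (0 : ℝ) 1) (hμ : 0 < μ) :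
    ∃ t u, (∀ n, 2 * t (n + 1) ≤ t n) ∧ IsLacunary NX NY c μ (fun n => a n * t n ^ θ) t u := by
  have hA : 0 < A := pos_of_mul_pos_left ((ha 1).trans_le (haA 0)) (ha 0).le
  have hl : 0 < min θ (1 - θ) := lt_min hθ.1 (sub_pos.2 hθ.2)
  set l := min θ (1 - θ)
  set δ := min (1 / 2) ((μ / A) ^ l⁻¹)
  have hδ0 : 0 < δ := by positivity
  have hδ2 : δ ≤ 1 / 2 := min_le_left _ _
  have hδ : A * δ ^ l ≤ μ := calc
    A * δ ^ l ≤ A * ((μ / A) ^ l⁻¹) ^ l := by gcongr; exact min_le_right _ _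
    _ = μ := by rw [Real.rpow_inv_rpow (by positivity) hl.ne']; field_simp
  obtain ⟨t, ht⟩ := exists_seq_succ_le_mul hext hδ0
  choose ht0 hu htδ using ht
  choose u huJ huK using hu
  have hgrowth : ∀ {η}, l ≤ η → ∀ n, t (n + 1) ^ η ≤ δ ^ l * t n ^ η := fun hη n =>
    rpow_le_rpow_mul_rpow_of_le_mul hδ0 (by linarith) (ht0 _).le (ht0 _).le (htδ n)
      (hl.le.trans hη) hη
  refine ⟨t, u, fun n => ?_, fun n => ?_, ht0, huJ, huK, fun n => ?_, fun n => ?_⟩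
  · nlinarith [htδ n, ht0 n]
  · exact mul_pos (ha n) (Real.rpow_pos_of_pos (ht0 n) θ)
  · have := ha n
    have := ht0 n
    have := ht0 (n + 1)
    calc a (n + 1) * t (n + 1) ^ θ ≤ A * a n * (δ ^ l * t n ^ θ) := by
          gcongr
          exacts [haA n, hgrowth (min_le_left _ _) n]
      _ = A * δ ^ l * (a n * t n ^ θ) := by ring
      _ ≤ _ := by gcongr
  · have := ha (n + 1)
    have := ht0 n
    have := ht0 (n + 1)
    have hdiv : ∀ n, t n ^ θ / t n = (t n ^ (1 - θ))⁻¹ := fun n => by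
      rw [← Real.rpow_sub_one (ht0 n).ne', ← Real.rpow_neg (ht0 n).le, neg_sub]
    simp only [mul_div_assoc, hdiv]
    calc a n * (t n ^ (1 - θ))⁻¹ ≤ A * a (n + 1) * (δ ^ l * (t (n + 1) ^ (1 - θ))⁻¹) := by
          gcongr
          · exact haA' n
          · rw [← div_eq_mul_inv, inv_le_comm₀ (by positivity) (by positivity), inv_div,
              div_le_iff₀' (by positivity)]
            exact hgrowth (min_le_right _ _) n
      _ = A * δ ^ l * (a (n + 1) * (t (n + 1) ^ (1 - θ))⁻¹) := by ring
      _ ≤ _ := by gcongr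

/-- `x` realizes the sequence `a` at the scales `t`: its `K`-functional is of the size of
`a n * t n ^ θ` at `t n`, and between these scales it stays below their geometric interpolation. -/
structure Realizes (NX : QuasiNorm 𝕜 E) {Y : Submodule 𝕜 E} (NY : QuasiNorm 𝕜 Y) (θ : ℝ)
    (a t : ℕ → ℝ) (x : E) : Prop where
  scale_pos : ∀ n, 0 < t n
  two_mul_scale_le : ∀ n, 2 * t (n + 1) ≤ t n
  lower : ∃ κ > 0, ∀ n, κ * (a n * t n ^ θ) ≤ peetreK NX NY x (t n)
  upper : ∃ D > 0, ∀ s > 0, ∃ m,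
    peetreK NX NY x s ≤ D * a m * s ^ θ * min (t m / s) (s / t m) ^ min θ (1 - θ)

theorem HasExtremalVectors.exists_realizes (hext : HasExtremalVectors NX NY c) (hc : 0 < c)
    (hX : NX.IsQuasiBanach) {a : ℕ → ℝ} (ha : ∀ n, 0 < a n) {A : ℝ}
    (haA : ∀ n, a (n + 1) ≤ A * a n) (haA' : ∀ n, a n ≤ A * a (n + 1)) {θ : ℝ}
    (hθ : θ ∈ Set.Ioo (0 : ℝ) 1) : ∃ t x, Realizes NX NY θ a t x := by
  obtain ⟨C, hC⟩ := exists_isModulus NX NY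
  have hC1 := hC.one_le
  set μ := min (1 / (2 * C)) (c / (8 * C ^ 4))
  have hμ0 : 0 < μ := by positivity
  have hμ : 2 * C * μ ≤ 1 := (le_div_iff₀' (by positivity)).1 (min_le_left _ _)
  have hμc : 8 * C ^ 4 * μ ≤ c := (le_div_iff₀' (by positivity)).1 (min_le_right _ _)
  obtain ⟨t, u, ht2, hlac⟩ := hext.exists_isLacunary ha haA haA' hθ hμ0
  have ht := hlac.scale_pos
  have ht0 : Tendsto t atTop (𝓝 0) := by
    refine squeeze_zero (fun n => (ht n).le) (fun n => le_geom (c := 1 / 2) (by norm_num) n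
      fun k _ => by linarith [ht2 k]) ?_
    simpa using (tendsto_pow_atTop_nhds_zero_of_lt_one (by norm_num : (0 : ℝ) ≤ 1 / 2)
      (by norm_num)).mul_const (t 0)
  obtain ⟨x, hx⟩ := hlac.exists_sub_sum_range_le hC hX hμ0.le hμ
  refine ⟨t, x, ht, ht2, ⟨c / (2 * C), by positivity,
    hlac.le_peetreK_of_sub_sum_range_le hC hμ0.le hμ hμc hx⟩, 4 * C ^ 3, by positivity,
    fun s hs => ?_⟩
  obtain ⟨m, hm⟩ := hlac.exists_peetreK_le_of_sub_sum_range_le hC hμ ht0 hx hs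
  have := ha m
  refine ⟨m, hm.trans ?_⟩
  calc 4 * C ^ 3 * (a m * t m ^ θ * min 1 (s / t m))
      = 4 * C ^ 3 * a m * (t m ^ θ * min 1 (s / t m)) := by ring
    _ ≤ 4 * C ^ 3 * a m * (s ^ θ * min (t m / s) (s / t m) ^ min θ (1 - θ)) :=
        mul_le_mul_of_nonneg_left (rpow_mul_min_one_div_le hs (ht m) θ) (by positivity)
    _ = _ := by ring

end Lacunary

section Interp

variable {NX : QuasiNorm 𝕜 E} {Y : Submodule 𝕜 E} {NY : QuasiNorm 𝕜 Y}

theorem mem_interp {θ : ℝ} {q : ℝ≥0∞} {x : E} :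
    x ∈ NX.interp NY θ q ↔ interpFunctional NX NY θ q x < ∞ := Iff.rfl

theorem mem_interp_iff_lintegral {θ : ℝ} {q : ℝ≥0∞} (hq0 : q ≠ 0) (hq : q ≠ ∞) {x : E} :
    x ∈ NX.interp NY θ q ↔ ∫⁻ s in Set.Ioi (0 : ℝ),
      ENNReal.ofReal (s⁻¹ * (s ^ (-θ) * peetreK NX NY x s) ^ q.toReal) < ∞ := by
  have hr : 0 < q.toReal := ENNReal.toReal_pos hq0 hq
  rw [mem_interp, interpFunctional, eLpNorm_lt_top_iff_lintegral_rpow_enorm_lt_top hq0 hq,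
    setLIntegral_congr_fun measurableSet_Ioi fun s (hs : 0 < s) => ?_]
  have hKs := peetreK_nonneg NX NY x hs.le
  rw [Real.enorm_of_nonneg (by positivity), ENNReal.ofReal_rpow_of_nonneg (by positivity) hr.le,
    neg_add, Real.rpow_add hs, mul_right_comm, mul_comm _ (s ^ (-(q⁻¹).toReal)),
    Real.mul_rpow (by positivity) (by positivity), ← Real.rpow_mul hs.le, ENNReal.toReal_inv,
    neg_mul, inv_mul_cancel₀ hr.ne', Real.rpow_neg_one]

theorem ofReal_le_eLpNorm_restrict_Ioc {θ : ℝ} (hθ : 0 ≤ θ) {q : ℝ≥0∞} (hq : q ≠ 0) (x : E)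
    {t : ℝ} (ht : 0 < t) :
    ENNReal.ofReal (2 ^ (-(θ + (q⁻¹).toReal)) * (t ^ (-θ) * peetreK NX NY x t)) ≤
      eLpNorm (fun s : ℝ => s ^ (-(θ + (q⁻¹).toReal)) * peetreK NX NY x s) q
        (volume.restrict (Set.Ioc t (2 * t))) := by
  have hKt := peetreK_nonneg NX NY x ht.le
  have hvol : volume (Set.Ioc t (2 * t)) = ENNReal.ofReal t := by
    rw [Real.volume_Ioc, two_mul, add_sub_cancel_right]
  calc ENNReal.ofReal (2 ^ (-(θ + (q⁻¹).toReal)) * (t ^ (-θ) * peetreK NX NY x t))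
      = ENNReal.ofReal ((2 * t) ^ (-(θ + (q⁻¹).toReal)) * peetreK NX NY x t *
          t ^ (q⁻¹).toReal) := by
        rw [Real.mul_rpow zero_le_two ht.le, show -θ = -(θ + (q⁻¹).toReal) + (q⁻¹).toReal by ring,
          Real.rpow_add ht]
        ring_nf
    _ = eLpNorm (fun _ : ℝ => (2 * t) ^ (-(θ + (q⁻¹).toReal)) * peetreK NX NY x t) q
          (volume.restrict (Set.Ioc t (2 * t))) := by
        rw [eLpNorm_const _ hq (Measure.restrict_eq_zero.not.2 (by simpa [hvol] using ht)),
          Measure.restrict_apply_univ, hvol, Real.enorm_of_nonneg (by positivity), one_div,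
          ← ENNReal.toReal_inv, ENNReal.ofReal_rpow_of_pos ht,
          ← ENNReal.ofReal_mul (by positivity)]
    _ ≤ _ := by
        refine eLpNorm_mono_ae ?_
        filter_upwards [ae_restrict_mem measurableSet_Ioc] with s hs
        have hs0 : 0 < s := ht.trans hs.1
        have hKs := peetreK_nonneg NX NY x hs0.le
        rw [Real.norm_of_nonneg (by positivity), Real.norm_of_nonneg (by positivity)]
        refine mul_le_mul ?_ (peetreK_mono NX NY x ht.le hs.1.le) hKt (by positivity)
        exact Real.rpow_le_rpow_of_nonpos hs0 hs.2 (by rw [neg_nonpos]; positivity)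

theorem exists_peetreK_le_of_mem_interp {θ : ℝ} (hθ : 0 ≤ θ) {q : ℝ≥0∞} (hq : q ≠ 0) {x : E}
    (hx : x ∈ NX.interp NY θ q) : ∃ D > 0, ∀ t > 0, peetreK NX NY x t ≤ D * t ^ θ := by
  set ρ := interpFunctional NX NY θ q x
  refine ⟨2 ^ (θ + (q⁻¹).toReal) * (ρ.toReal + 1), by positivity, fun t ht => ?_⟩
  have hle : ENNReal.ofReal (2 ^ (-(θ + (q⁻¹).toReal)) * (t ^ (-θ) * peetreK NX NY x t)) ≤ ρ :=
    (ofReal_le_eLpNorm_restrict_Ioc hθ hq x ht).trans <| eLpNorm_mono_measure _ <|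
      Measure.restrict_mono (fun s hs => ht.trans hs.1) le_rfl
  rw [ENNReal.ofReal_le_iff_le_toReal (mem_interp.1 hx).ne, Real.rpow_neg zero_le_two,
    Real.rpow_neg ht.le, inv_mul_le_iff₀ (by positivity), inv_mul_le_iff₀ (by positivity)] at hle
  calc peetreK NX NY x t ≤ t ^ θ * (2 ^ (θ + (q⁻¹).toReal) * ρ.toReal) := hle
    _ ≤ t ^ θ * (2 ^ (θ + (q⁻¹).toReal) * (ρ.toReal + 1)) := by gcongr; linarith
    _ = _ := mul_comm _ _

theorem memℓp_of_mem_interp {θ : ℝ} (hθ : 0 ≤ θ) {q : ℝ≥0∞} (hq : q ≠ 0) {x : E}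
    (hx : x ∈ NX.interp NY θ q) {t : ℕ → ℝ} (ht : ∀ n, 0 < t n)
    (ht2 : ∀ n, 2 * t (n + 1) ≤ t n) :
    Memℓp (fun n => t n ^ (-θ) * peetreK NX NY x (t n)) q := by
  have hnonneg : ∀ n, 0 ≤ t n ^ (-θ) * peetreK NX NY x (t n) := fun n =>
    mul_nonneg (Real.rpow_nonneg (ht n).le _) (peetreK_nonneg NX NY x (ht n).le)
  rcases eq_or_ne q ∞ with rfl | hq'
  · obtain ⟨D, -, hD⟩ := exists_peetreK_le_of_mem_interp hθ hq hx
    refine memℓp_infty ⟨D, Set.forall_mem_range.2 fun n => ?_⟩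
    rw [Real.norm_of_nonneg (hnonneg n), Real.rpow_neg (ht n).le,
      inv_mul_le_iff₀ (Real.rpow_pos_of_pos (ht n) _), mul_comm]
    exact hD _ (ht n)
  have hr : 0 < q.toReal := ENNReal.toReal_pos hq hq'
  have hanti : Antitone t := antitone_nat_of_succ_le fun n => by linarith [ht2 n, ht (n + 1)]
  have hdisj : Pairwise (Function.onFun Disjoint fun n => Set.Ioc (t n) (2 * t n)) := by
    refine (pairwise_disjoint_on _).2 fun m n hmn => Set.disjoint_left.2 fun s hs hs' => ?_
    linarith [hanti (Nat.succ_le_of_lt hmn), ht2 m, hs.1, hs'.2]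
  set c : ℝ := 2 ^ (-(θ + (q⁻¹).toReal))
  have hc : 0 < c := by positivity
  have hsum : ∑' n, ENNReal.ofReal ((c * (t n ^ (-θ) * peetreK NX NY x (t n))) ^ q.toReal) ≠ ∞ := by
    refine ne_top_of_le_ne_top (ENNReal.rpow_ne_top_of_nonneg hr.le (mem_interp.1 hx).ne)
      (le_trans (ENNReal.tsum_le_tsum fun n => ?_) (tsum_eLpNorm_restrict_rpow_le _ hq hq'
        (fun n => measurableSet_Ioc) hdisj fun n s hs => (ht n).trans hs.1))
    rw [← ENNReal.ofReal_rpow_of_nonneg (mul_nonneg hc.le (hnonneg n)) hr.le]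
    exact ENNReal.rpow_le_rpow (ofReal_le_eLpNorm_restrict_Ioc hθ hq x (ht n)) hr.le
  refine memℓp_gen ((summable_mul_left_iff (by positivity : c ^ q.toReal ≠ 0)).1 ?_)
  refine (ENNReal.summable_toReal hsum).congr fun n => ?_
  rw [ENNReal.toReal_ofReal (Real.rpow_nonneg (mul_nonneg hc.le (hnonneg n)) _),
    Real.mul_rpow hc.le (hnonneg n), Real.norm_of_nonneg (hnonneg n)]

theorem mem_interp_top_of_peetreK_le {θ : ℝ} {x : E} {D : ℝ}
    (h : ∀ t > 0, peetreK NX NY x t ≤ D * t ^ θ) : x ∈ NX.interp NY θ ∞ := by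
  rw [mem_interp, interpFunctional, eLpNorm_exponent_top]
  refine eLpNormEssSup_lt_top_of_ae_bound (C := D) ?_
  filter_upwards [ae_restrict_mem measurableSet_Ioi] with t (ht : 0 < t)
  have hKt := peetreK_nonneg NX NY x ht.le
  rw [Real.norm_of_nonneg (by positivity), ENNReal.inv_top, ENNReal.toReal_zero, add_zero,
    Real.rpow_neg ht.le, inv_mul_le_iff₀ (by positivity), mul_comm]
  exact h t ht

theorem mem_interp_of_memℓp {ι : Type*} [Countable ι] {θ τ : ℝ} (hτ : 0 < τ) {q : ℝ≥0∞}
    (hq : q ≠ 0) {a t : ι → ℝ} (ha : ∀ m, 0 ≤ a m) (ht : ∀ m, 0 < t m) (haq : Memℓp a q) {x : E}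
    (h : ∀ s > 0, ∃ m, peetreK NX NY x s ≤ a m * s ^ θ * min (t m / s) (s / t m) ^ τ) :
    x ∈ NX.interp NY θ q := by
  rcases eq_or_ne q ∞ with rfl | hq'
  · obtain ⟨D, hD⟩ := haq.bddAbove
    refine mem_interp_top_of_peetreK_le (D := D) fun s hs => ?_
    obtain ⟨m, hm⟩ := h s hs
    have htm := ht m
    have ham := ha m
    calc peetreK NX NY x s ≤ a m * s ^ θ * min (t m / s) (s / t m) ^ τ := hm
      _ ≤ a m * s ^ θ := mul_le_of_le_one_right (by positivity)
          (Real.rpow_le_one (by positivity) (min_div_div_le_one htm hs) hτ.le)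
      _ ≤ D * s ^ θ := by
          gcongr
          exact (Real.le_norm_self _).trans (hD ⟨m, rfl⟩)
  have hr : 0 < q.toReal := ENNReal.toReal_pos hq hq'
  have hsum := haq.summable hr
  simp only [Real.norm_of_nonneg (ha _)] at hsum
  refine (mem_interp_iff_lintegral hq hq').2 (lintegral_inv_mul_rpow_lt_top hτ hr ha ht hsum
    fun s hs => ⟨?_, ?_⟩)
  · exact mul_nonneg (Real.rpow_nonneg hs.le _) (peetreK_nonneg NX NY x hs.le)
  · obtain ⟨m, hm⟩ := h s hs
    refine ⟨m, ?_⟩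
    rwa [Real.rpow_neg hs.le, inv_mul_le_iff₀ (by positivity), ← mul_assoc, mul_comm (s ^ θ)]

theorem mem_interp_of_peetreK_le {θ σ : ℝ} (hθ : 0 < θ) (hσ : θ < σ) {q : ℝ≥0∞} (hq : q ≠ 0)
    {x : E} {D : ℝ} (h : ∀ t > 0, t ≤ 1 → peetreK NX NY x t ≤ D * t ^ σ) :
    x ∈ NX.interp NY θ q := by
  have hD : 0 ≤ D := by
    simpa using (peetreK_nonneg NX NY x zero_le_one).trans (h 1 one_pos le_rfl)
  have hN := NX.nonneg' x
  refine mem_interp_of_memℓp (ι := Unit) (τ := min (σ - θ) θ) (a := fun _ => D + NX x)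
    (t := fun _ => 1) (lt_min (sub_pos.2 hσ) hθ) hq (fun _ => by positivity) (fun _ => one_pos)
    (Memℓp.all _) fun s hs => ⟨(), ?_⟩
  rw [div_one, mul_assoc]
  rcases le_total s 1 with hs1 | hs1
  · rw [min_eq_right (hs1.trans ((one_le_div hs).2 hs1)), ← Real.rpow_add hs]
    refine (h s hs hs1).trans (mul_le_mul (by linarith) ?_ (by positivity) (by positivity))
    exact Real.rpow_le_rpow_of_exponent_ge hs hs1 (by linarith [min_le_left (σ - θ) θ])
  · rw [min_eq_left (((div_le_one hs).2 hs1).trans hs1), one_div, Real.inv_rpow hs.le,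
      ← Real.rpow_neg hs.le, ← Real.rpow_add hs]
    refine (peetreK_le_left NX NY x hs.le).trans ((le_add_of_nonneg_left hD).trans ?_)
    exact le_mul_of_one_le_right (by positivity)
      (Real.one_le_rpow hs1 (by linarith [min_le_right (σ - θ) θ]))

theorem le_interp {θ : ℝ} (hθ : θ ∈ Set.Ioo (0 : ℝ) 1) {q : ℝ≥0∞} (hq : q ≠ 0) :
    Y ≤ NX.interp NY θ q := fun y hy =>
  mem_interp_of_peetreK_le hθ.1 hθ.2 hq (D := NY ⟨y, hy⟩) fun t ht _ => by
    rw [Real.rpow_one, mul_comm]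
    exact peetreK_le_right NX NY ⟨y, hy⟩ ht.le

theorem interp_le_interp {θ θ' : ℝ} (hθ : 0 < θ) (hθ' : θ < θ') {p q : ℝ≥0∞} (hp : p ≠ 0)
    (hq : q ≠ 0) : NX.interp NY θ' p ≤ NX.interp NY θ q := fun _ hx =>
  let ⟨_, _, hD⟩ := exists_peetreK_le_of_mem_interp (hθ.trans hθ').le hp hx
  mem_interp_of_peetreK_le hθ hθ' hq fun t ht _ => hD t ht

theorem IsClosedSet.mem_of_forall_exists_sub_lt {S : Set E} (hS : NX.IsClosedSet S) {x : E}
    (h : ∀ ε > 0, ∃ y ∈ S, NX (x - y) < ε) : x ∈ S := by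
  choose y hyS hy using fun n : ℕ => h (1 / ((n : ℝ) + 1)) (by positivity)
  refine hS y x hyS (squeeze_zero (fun n => NX.nonneg' _) (fun n => ?_)
    tendsto_one_div_add_atTop_nhds_zero_nat)
  rw [NX.map_sub_rev]
  exact (hy n).le

theorem interp_eq_of_isClosedSet (hclosed : NX.IsClosedSet (Y : Set E)) {θ : ℝ}
    (hθ : θ ∈ Set.Ioo (0 : ℝ) 1) {q : ℝ≥0∞} (hq : q ≠ 0) : NX.interp NY θ q = Y := by
  refine le_antisymm (fun x hx => ?_) (le_interp hθ hq)
  obtain ⟨D, hD0, hD⟩ := exists_peetreK_le_of_mem_interp hθ.1.le hq hx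
  refine hclosed.mem_of_forall_exists_sub_lt fun ε hε => ?_
  set t := (ε / (2 * D)) ^ θ⁻¹
  have ht : 0 < t := by positivity
  have hKt : peetreK NX NY x t < ε := by
    refine (hD t ht).trans_lt ?_
    rw [Real.rpow_inv_rpow (by positivity) hθ.1.ne']
    field_simp
    norm_num
  obtain ⟨y, hy⟩ := exists_lt_of_peetreK_lt NX NY hKt
  exact ⟨y, y.2, by linarith [mul_nonneg ht.le (NY.nonneg' y)]⟩

theorem Realizes.mem_interp_iff {θ : ℝ} {a t : ℕ → ℝ} {x : E} (h : Realizes NX NY θ a t x)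
    (ha : ∀ n, 0 ≤ a n) (hθ : θ ∈ Set.Ioo (0 : ℝ) 1) {q : ℝ≥0∞} (hq : q ≠ 0) :
    x ∈ NX.interp NY θ q ↔ Memℓp a q := by
  refine ⟨fun hx => ?_, fun haq => ?_⟩
  · obtain ⟨κ, hκ, hlower⟩ := h.lower
    refine ((memℓp_of_mem_interp hθ.1.le hq hx h.scale_pos h.two_mul_scale_le).const_mul
      κ⁻¹).mono fun n => ?_
    have htn := h.scale_pos n
    rw [Real.norm_of_nonneg (ha n), Real.rpow_neg htn.le, inv_mul_eq_div, inv_mul_eq_div,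
      div_div, le_div_iff₀ (by positivity)]
    exact (by ring : _ = _).trans_le (hlower n)
  · obtain ⟨D, hD, hupper⟩ := h.upper
    exact mem_interp_of_memℓp (lt_min hθ.1 (sub_pos.2 hθ.2)) hq
      (fun n => mul_nonneg hD.le (ha n)) h.scale_pos (haq.const_mul D) hupper

theorem exists_mem_interp_notMem_interp (hX : NX.IsQuasiBanach) (hY : NY.IsQuasiBanach)
    (hYX : NX.ContinuouslyEmbedded NY) (hclosed : ¬ NX.IsClosedSet (Y : Set E)) {θ : ℝ}
    (hθ : θ ∈ Set.Ioo (0 : ℝ) 1) {p q : ℝ≥0∞} (hp : p ≠ 0) (hpq : p < q) :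
    ∃ x ∈ NX.interp NY θ q, x ∉ NX.interp NY θ p := by
  obtain ⟨c, hc, hext⟩ := exists_hasExtremalVectors_of_not_isClosedSet hY hYX hclosed
  set a : ℕ → ℝ := fun n => ((n : ℝ) + 1) ^ (-p.toReal⁻¹)
  have ha : ∀ n, 0 < a n := fun n => by positivity
  have hanti : ∀ n, a (n + 1) ≤ a n := fun n =>
    Real.rpow_le_rpow_of_nonpos (by positivity) (by push_cast; linarith) (by simp)
  have hslow : ∀ n, a n ≤ 2 ^ p.toReal⁻¹ * a (n + 1) := fun n => by
    have hn : (0 : ℝ) < (n + 1 : ℕ) + 1 := by positivity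
    calc a n = 2 ^ p.toReal⁻¹ * (2 * ((n : ℝ) + 1)) ^ (-p.toReal⁻¹) := by
          rw [Real.mul_rpow zero_le_two (by positivity), ← mul_assoc, ← Real.rpow_add two_pos,
            add_neg_cancel, Real.rpow_zero, one_mul]
      _ ≤ 2 ^ p.toReal⁻¹ * a (n + 1) := by
          gcongr ?_ * ?_
          exact Real.rpow_le_rpow_of_nonpos hn (by push_cast; linarith) (by simp)
  obtain ⟨t, x, hx⟩ := hext.exists_realizes hc hX ha (fun n => (hanti n).trans
    (le_mul_of_one_le_left (ha n).le (Real.one_le_rpow one_le_two (by simp)))) hslow hθ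
  have hiff : ∀ {r : ℝ≥0∞}, r ≠ 0 → (x ∈ NX.interp NY θ r ↔ p < r) := fun hr =>
    (hx.mem_interp_iff (fun n => (ha n).le) hθ hr).trans
      (memℓp_add_one_rpow_neg_inv_iff hp hpq.ne_top hr)
  exact ⟨x, (hiff hpq.ne_bot).2 hpq, fun hxp => lt_irrefl p ((hiff hp).1 hxp)⟩

theorem interp_ne_interp_of_ne (hX : NX.IsQuasiBanach) (hY : NY.IsQuasiBanach)
    (hYX : NX.ContinuouslyEmbedded NY) (hclosed : ¬ NX.IsClosedSet (Y : Set E)) {θ : ℝ}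
    (hθ : θ ∈ Set.Ioo (0 : ℝ) 1) {p q : ℝ≥0∞} (hp : p ≠ 0) (hq : q ≠ 0) (hpq : p ≠ q) :
    NX.interp NY θ p ≠ NX.interp NY θ q := by
  wlog h : p < q generalizing p q
  · exact (this hq hp hpq.symm (hpq.lt_or_gt.resolve_left h)).symm
  obtain ⟨x, hxq, hxp⟩ := exists_mem_interp_notMem_interp hX hY hYX hclosed hθ hp h
  exact fun heq => hxp (heq ▸ hxq)

theorem interp_lt_interp (hX : NX.IsQuasiBanach) (hY : NY.IsQuasiBanach)
    (hYX : NX.ContinuouslyEmbedded NY) (hclosed : ¬ NX.IsClosedSet (Y : Set E)) {θ θ' : ℝ}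
    (hθ : 0 < θ) (hθθ' : θ < θ') (hθ' : θ' < 1) {p q : ℝ≥0∞} (hp : p ≠ 0) (hq : q ≠ 0) :
    NX.interp NY θ' q < NX.interp NY θ p := by
  refine (interp_le_interp hθ hθθ' hq hp).lt_of_not_ge fun hle => ?_
  obtain ⟨σ, hσ, hσ'⟩ := exists_between hθθ'
  obtain ⟨x, hx, hx'⟩ := exists_mem_interp_notMem_interp hX hY hYX hclosed
    ⟨hθ.trans hσ, hσ'.trans hθ'⟩ one_ne_zero ENNReal.one_lt_two
  exact hx' (interp_le_interp (hθ.trans hσ) hσ' hq one_ne_zero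
    (hle (interp_le_interp hθ hσ two_ne_zero hp hx)))

theorem hasInfiniteCodimIn_interp_top (hX : NX.IsQuasiBanach) (hY : NY.IsQuasiBanach)
    (hYX : NX.ContinuouslyEmbedded NY) (hclosed : ¬ NX.IsClosedSet (Y : Set E)) {θ : ℝ}
    (hθ : θ ∈ Set.Ioo (0 : ℝ) 1) {p : ℝ≥0∞} (hp : p ≠ 0) :
    HasInfiniteCodimIn (NX.interp NY θ p) ⊤ := by
  obtain ⟨η, hη, hηθ, -⟩ := exists_seq_strictMono_tendsto' hθ.1
  exact .of_strictAnti (S := fun n => NX.interp NY (η n) p)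
    (fun m n hmn => interp_lt_interp hX hY hYX hclosed (hηθ m).1 (hη hmn)
      ((hηθ n).2.trans hθ.2) hp hp)
    (fun n => interp_le_interp (hηθ n).1 (hηθ n).2 hp hp) fun _ => le_top

theorem hasInfiniteCodimIn_interp (hX : NX.IsQuasiBanach) (hY : NY.IsQuasiBanach)
    (hYX : NX.ContinuouslyEmbedded NY) (hclosed : ¬ NX.IsClosedSet (Y : Set E)) {θ : ℝ}
    (hθ : θ ∈ Set.Ioo (0 : ℝ) 1) {p : ℝ≥0∞} (hp : p ≠ 0) :
    HasInfiniteCodimIn Y (NX.interp NY θ p) := by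
  obtain ⟨η, hη, hθη, -⟩ := exists_seq_strictMono_tendsto' hθ.2
  have hη0 : ∀ n, 0 < η n := fun n => hθ.1.trans (hθη n).1
  exact .of_strictAnti (S := fun n => NX.interp NY (η n) p)
    (fun m n hmn => interp_lt_interp hX hY hYX hclosed (hη0 m) (hη hmn) (hθη n).2 hp hp)
    (fun n => le_interp ⟨hη0 n, (hθη n).2⟩ hp)
    fun n => interp_le_interp hθ.1 (hθη n).1 hp hp

end Interp

end QuasiNorm

theorem theorem5_general {𝕜 : Type*} [RCLike 𝕜] {X : Type*} [AddCommGroup X] [Module 𝕜 X]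
    (NX : QuasiNorm 𝕜 X) (Y : Submodule 𝕜 X) (NY : QuasiNorm 𝕜 Y)
    (hX : NX.IsQuasiBanach) (hY : NY.IsQuasiBanach) (hYX : NX.ContinuouslyEmbedded NY) :
    (¬ NX.IsClosedSet (Y : Set X) →
      ∀ (θ₀ θ₁ : ℝ) (p q : ℝ≥0∞), θ₀ ∈ Set.Ioo (0 : ℝ) 1 → θ₁ ∈ Set.Ioo (0 : ℝ) 1 → θ₀ ≠ θ₁ →
        0 < p → 0 < q → NX.interp NY θ₀ p ≠ NX.interp NY θ₁ q) ∧
    (∀ (θ₀ θ₁ : ℝ) (p q : ℝ≥0∞), θ₀ ∈ Set.Ioo (0 : ℝ) 1 → θ₁ ∈ Set.Ioo (0 : ℝ) 1 →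
      0 < p → 0 < q → NX.interp NY θ₀ p ≠ NX.interp NY θ₁ q →
      ∀ (θ : ℝ) (r₁ r₂ : ℝ≥0∞), θ ∈ Set.Ioo (0 : ℝ) 1 → 0 < r₁ → 0 < r₂ → r₁ ≠ r₂ →
        NX.interp NY θ r₁ ≠ NX.interp NY θ r₂) ∧
    (¬ NX.IsClosedSet (Y : Set X) →
      ∀ (θ : ℝ) (p : ℝ≥0∞), θ ∈ Set.Ioo (0 : ℝ) 1 → 0 < p →
        HasInfiniteCodimIn (NX.interp NY θ p) ⊤ ∧ HasInfiniteCodimIn Y (NX.interp NY θ p)) := by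
  refine ⟨fun hclosed θ₀ θ₁ p q hθ₀ hθ₁ hne hp hq => ?_,
    fun θ₀ θ₁ p q hθ₀ hθ₁ hp hq hne θ r₁ r₂ hθ hr₁ hr₂ hr => ?_,
    fun hclosed θ p hθ hp =>
      ⟨QuasiNorm.hasInfiniteCodimIn_interp_top hX hY hYX hclosed hθ hp.ne',
        QuasiNorm.hasInfiniteCodimIn_interp hX hY hYX hclosed hθ hp.ne'⟩⟩
  · rcases hne.lt_or_gt with h | h
    · exact (QuasiNorm.interp_lt_interp hX hY hYX hclosed hθ₀.1 h hθ₁.2 hp.ne' hq.ne').ne'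
    · exact (QuasiNorm.interp_lt_interp hX hY hYX hclosed hθ₁.1 h hθ₀.2 hq.ne' hp.ne').ne
  · refine QuasiNorm.interp_ne_interp_of_ne hX hY hYX (fun hclosed => hne ?_) hθ hr₁.ne' hr₂.ne' hr
    rw [QuasiNorm.interp_eq_of_isClosedSet hclosed hθ₀ hp.ne',
      QuasiNorm.interp_eq_of_isClosedSet hclosed hθ₁ hq.ne']

theorem theorem5 {𝕜 : Type*} [RCLike 𝕜] {X : Type*} [AddCommGroup X] [Module 𝕜 X]
    (NX : QuasiNorm 𝕜 X) (Y : Submodule 𝕜 X) (NY : QuasiNorm 𝕜 Y)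
    (hX : NX.IsQuasiBanach) (hY : NY.IsQuasiBanach)
    (hYX : NX.ContinuouslyEmbedded NY) (hne : Y ≠ ⊤) :
    -- (a)
    (¬ NX.IsClosedSet (Y : Set X) →
      ∀ (θ₀ θ₁ : ℝ) (p q : ℝ≥0∞), θ₀ ∈ Set.Ioo (0 : ℝ) 1 → θ₁ ∈ Set.Ioo (0 : ℝ) 1 → θ₀ ≠ θ₁ →
        0 < p → 0 < q → NX.interp NY θ₀ p ≠ NX.interp NY θ₁ q) ∧
    -- (b)
    (∀ (θ : ℝ) (p q : ℝ≥0∞), θ ∈ Set.Ioo (0 : ℝ) 1 → 0 < p → 0 < q →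
      NX.interp NY θ p ≠ NX.interp NY θ q →
      ∀ r₁ r₂ : ℝ≥0∞, r₁ ∈ Set.uIcc p q → r₂ ∈ Set.uIcc p q → r₁ ≠ r₂ →
        NX.interp NY θ r₁ ≠ NX.interp NY θ r₂) ∧
    -- (c)
    (¬ NX.IsClosedSet (Y : Set X) →
      ∀ (θ : ℝ) (p : ℝ≥0∞), θ ∈ Set.Ioo (0 : ℝ) 1 → 0 < p →
        HasInfiniteCodimIn (NX.interp NY θ p) ⊤ ∧ HasInfiniteCodimIn Y (NX.interp NY θ p)) := by
  obtain ⟨ha, hb, hc⟩ := theorem5_general NX Y NY hX hY hYX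
  exact ⟨ha, fun θ p q hθ hp hq hpq r₁ r₂ hr₁ hr₂ => hb θ θ p q hθ hθ hp hq hpq θ r₁ r₂ hθ
    ((lt_min hp hq).trans_le hr₁.1) ((lt_min hp hq).trans_le hr₂.1), hc⟩
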